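/- For $a\in\mathbb C$ consider the $3\times 3$ system in $\mathbb R^3$ with coordinates $(t,x,y)$ \[ L_a=\frac{\partial}{\partial t}+\begin{pmatrix}0&1&0\\1&0&0\\0&0&0\end{pmatrix}\frac{\partial}{\partial x} +x\begin{pmatrix}0&a&1\\-a&0&0\\1+a^2&0&0\end{pmatrix}\frac{\partial}{\partial y}. \] For $s>0$ let $\gamma_0^{(s)}(\mathbb R^2;\mathbb C^3)$ be the set of compactly supported $C^\infty$ functions $f:\mathbb R^2\to\mathbb C^3$ such that for every compact set $K\subset\mathbb R^2$ there are $C,A>0$ with $|\partial^\alpha f(z)|\le C A^{|\alpha|}(|\alpha|!)^s$ for all $z\in K$ and all $\alpha\in\mathbb N^2$. The Cauchy problem for $L_a$ is called locally solvable (at the origin) in the Gevrey class of order $s$ if for every $U_0\in\gamma_0^{(s)}(\mathbb R^2;\mathbb C^3)$ there are an open neighbourhood $\Omega$ of the origin of $\mathbb R^3$ and $U\in C^1(\Omega;\mathbb C^3)$ such that $L_aU=0$ in $\Omega$ and $U(0,x,y)=U_0(x,y)$ whenever $(0,x,y)\in\Omega$. Theorem. Assume that $ia\notin[-1,1]$.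 Then for every real $s>2$ the Cauchy problem for $L_a$ is not locally solvable in the Gevrey class of order $s$; that is, there is $U_0\in\gamma_0^{(s)}(\mathbb R^2;\mathbb C^3)$ such that in no neighbourhood $\Omega$ of the origin does the Cauchy problem $L_aU=0$, $U(0,x,y)=U_0(x,y)$ have a $C^1(\Omega)$ solution. -/

import Mathlib

open scoped ContDiff

noncomputable section

namespace GevreyCauchy

/-- The partial derivative `∂f/∂x_i` of a function on `ℝ^d`. -/
def partialDeriv {d : ℕ} {E : Type*} [NormedAddCommGroup E] [NormedSpace ℝ E]
    (i : Fin d) (f : (Fin d → ℝ) → E) : (Fin d → ℝ) → E :=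
  fun p => lineDeriv ℝ f p (Pi.single i 1)

/-- The derivative `∂^α f = ∂_0^{α_0} ⋯ ∂_{d-1}^{α_{d-1}} f` for a multi-index `α ∈ ℕ^d`.
(The operators `D = -i∂` and `∂` give derivatives of the same absolute value.) -/
def multiDeriv {d : ℕ} {E : Type*} [NormedAddCommGroup E] [NormedSpace ℝ E]
    (α : Fin d → ℕ) (f : (Fin d → ℝ) → E) : (Fin d → ℝ) → E :=
  (List.finRange d).foldr (fun i g => (partialDeriv i)^[α i] g) f

/-- The Gevrey class `γ^{(s)}(ℝ^d)` of order `s`: smooth functions such that on every compact set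
`K` one has `|∂^α f| ≤ C A^{|α|} (|α|!)^s` for all multi-indices `α`, with `C, A > 0` depending
only on `f` and `K`. -/
def IsGevrey {d : ℕ} {E : Type*} [NormedAddCommGroup E] [NormedSpace ℝ E]
    (s : ℝ) (f : (Fin d → ℝ) → E) : Prop :=
  ContDiff ℝ ∞ f ∧
    ∀ K : Set (Fin d → ℝ), IsCompact K →
      ∃ C : ℝ, 0 < C ∧ ∃ A : ℝ, 0 < A ∧ ∀ x ∈ K, ∀ α : Fin d → ℕ,
        ‖multiDeriv α f x‖ ≤ C * A ^ (∑ i, α i) * ((Nat.factorial (∑ i, α i) : ℕ) : ℝ) ^ s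

/-- The class `γ_0^{(s)}(ℝ^d)` of compactly supported Gevrey functions of order `s`. -/
def IsGevreyCompact {d : ℕ} {E : Type*} [NormedAddCommGroup E] [NormedSpace ℝ E]
    (s : ℝ) (f : (Fin d → ℝ) → E) : Prop :=
  IsGevrey s f ∧ HasCompactSupport f

/-- The coefficient matrix of `∂_x`. -/
def matA : Matrix (Fin 3) (Fin 3) ℂ :=
  !![0, 1, 0;
     1, 0, 0;
     0, 0, 0]

/-- The coefficient matrix of `x ∂_y`. -/
def matB (a : ℂ) : Matrix (Fin 3) (Fin 3) ℂ :=
  !![0, a, 1;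
     -a, 0, 0;
     1 + a ^ 2, 0, 0]

/-- The operator `L_a = ∂_t + A ∂_x + x B ∂_y`, the coordinates of a point `p` of `ℝ^3` being
`(t, x, y) = (p 0, p 1, p 2)`. -/
def opL (a : ℂ) (U : (Fin 3 → ℝ) → (Fin 3 → ℂ)) (p : Fin 3 → ℝ) : Fin 3 → ℂ :=
  partialDeriv 0 U p + matA.mulVec (partialDeriv 1 U p)
    + ((p 1 : ℝ) : ℂ) • (matB a).mulVec (partialDeriv 2 U p)

/-- `U` is a `C^1` solution in the open set `Ω ⊆ ℝ^3` of the Cauchy problem `L_a U = 0`,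
`U(0, x, y) = U₀(x, y)`. -/
def IsCauchySolution (a : ℂ) (U₀ : (Fin 2 → ℝ) → (Fin 3 → ℂ)) (Ω : Set (Fin 3 → ℝ))
    (U : (Fin 3 → ℝ) → (Fin 3 → ℂ)) : Prop :=
  ContDiffOn ℝ 1 U Ω ∧
    (∀ p ∈ Ω, opL a U p = 0) ∧
    ∀ x y : ℝ, ![0, x, y] ∈ Ω → U ![0, x, y] = U₀ ![x, y]

/-- Local solvability at the origin, in the Gevrey class of order `s`, of the Cauchy problem for
`L_a` with data on `{t = 0}`: for all initial data of class `γ_0^{(s)}(ℝ^2)` there is a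
neighbourhood `Ω` of the origin, allowed to depend on the data, in which the Cauchy problem has a
`C^1` solution. -/
def LocallySolvable (a : ℂ) (s : ℝ) : Prop :=
  ∀ U₀ : (Fin 2 → ℝ) → (Fin 3 → ℂ), IsGevreyCompact s U₀ →
    ∃ Ω : Set (Fin 3 → ℝ), IsOpen Ω ∧ (0 : Fin 3 → ℝ) ∈ Ω ∧
      ∃ U : (Fin 3 → ℝ) → (Fin 3 → ℂ), IsCauchySolution a U₀ Ω U

end GevreyCauchy

end

/-!
The proof is by duality with exact solutions of the adjoint system that grow like `e^{cβ}`
backwards in time, where `β²` is comparable to the frequency, and that are exponentially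
concentrated at the origin.

Choose `ε = ±1` and `κ` with `κ² = -(1 + iεa)` and `Re κ > 0`; this is possible exactly because
`ia ∉ [-1, 1]` (`exists_growth_rate`). If `h` depends on `(x, y)` only through `x²/2 + iεy`, then
the substitution `Φ = (∂_t h, -(∂_x + a x ∂_y) h, -x ∂_y h)` reduces the adjoint system to the heat
equation `∂_t² H = (1 + iεa) ∂_q H`, `q = x²/2 + iεy`. Its solution `A^{-1/2} exp (B² / (4A))` with
`A = δ + x²/2 + iεy` and `B = b + κ (T - t)`, a superposition of `e^{-Aσ² + Bσ}` over `σ`, gives the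
wave packets `testSolution`. With `b` of real part `β`, they are `O((1 + β)² e^{β²/(4δ)})` at
time `T` and on the sides of a small box. Since the flux of a solution `U` against an adjoint
solution is divergence free, a `C¹` solution near the origin bounds the pairing of its Cauchy data
with the packets at time `0` by the same quantity (`exists_norm_integral_profile_le`).

For the data, take near the origin `U₀ = (F(y), 0, 0)` with
`F(y) = e^{-y²} ∑_j e^{-2j} e^{iε j^s y}`. It is of Gevrey order `s`, and its Fourier transform is a
positive combination of Gaussians. Hence the pairing is, up to a constant factor, an integral of
nonnegative terms, and the term with `R² = j^s`, for `β = 2δR`, bounds it below by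
`e^{β²/(4δ)} e^{(Re κ) T R - 2j}` up to powers of `R` (`le_norm_integral_profile`). As `s > 2`, the
growth `(Re κ) T j^{s/2}` beats `2j`, and the two bounds are incompatible
(`exists_large_frequency`).
-/

noncomputable section

namespace GevreyCauchy

open scoped Nat
open MeasureTheory Set Filter Topology

/-! ### Gevrey functions with global bounds -/

/-- Smooth functions whose iterated Fréchet derivatives obey the Gevrey bounds of order `s` on the
whole space, with the same constants at every point. -/
def UniformGevrey {E F : Type*} [NormedAddCommGroup E] [NormedSpace ℝ E]
    [NormedAddCommGroup F] [NormedSpace ℝ F] (s : ℝ) (f : E → F) : Prop :=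
  ContDiff ℝ ∞ f ∧ ∃ C : ℝ, 0 < C ∧ ∃ A : ℝ, 0 < A ∧ ∀ (n : ℕ) (x : E),
    ‖iteratedFDeriv ℝ n f x‖ ≤ C * A ^ n * (n ! : ℝ) ^ s

section calculus

variable {E F G : Type*} [NormedAddCommGroup E] [NormedSpace ℝ E]
  [NormedAddCommGroup F] [NormedSpace ℝ F] [NormedAddCommGroup G] [NormedSpace ℝ G]

/-- A mixed partial derivative of order `n` is the `n`-th Fréchet derivative evaluated at coordinate
vectors. -/
theorem exists_partialDeriv_iterate_eq_iteratedFDeriv {d : ℕ} {f : (Fin d → ℝ) → F}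
    (hf : ContDiff ℝ ∞ f) (i : Fin d) (k : ℕ) {n : ℕ} {g : (Fin d → ℝ) → F}
    {v : Fin n → Fin d → ℝ} (hv : ∀ j, ‖v j‖ ≤ 1) (hg : ∀ x, g x = iteratedFDeriv ℝ n f x v) :
    ∃ w : Fin (k + n) → Fin d → ℝ, (∀ j, ‖w j‖ ≤ 1) ∧
      ∀ x, (partialDeriv i)^[k] g x = iteratedFDeriv ℝ (k + n) f x w := by
  induction k with
  | zero =>
    rw [Nat.zero_add]
    exact ⟨v, hv, hg⟩
  | succ k ih =>
    obtain ⟨w, hw, h⟩ := ih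
    have hkn : k + 1 + n = (k + n) + 1 := by omega
    suffices H : ∃ w' : Fin ((k + n) + 1) → Fin d → ℝ, (∀ j, ‖w' j‖ ≤ 1) ∧
      ∀ x, (partialDeriv i)^[k + 1] g x = iteratedFDeriv ℝ ((k + n) + 1) f x w' by
      rw [hkn]; exact H
    refine ⟨Fin.cons (Pi.single i 1) w, fun j => ?_, fun x => ?_⟩
    · refine Fin.cases ?_ (fun j => ?_) j
      · simp [Pi.norm_single]
      · simpa using hw j
    · have hd : DifferentiableAt ℝ (iteratedFDeriv ℝ (k + n) f) x :=
        hf.contDiffAt.differentiableAt_iteratedFDeriv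
          (by exact_mod_cast WithTop.coe_lt_coe.2 (ENat.natCast_lt_top _))
      have hfun : (partialDeriv i)^[k] g = fun x => iteratedFDeriv ℝ (k + n) f x w := funext h
      rw [Function.iterate_succ_apply', hfun, iteratedFDeriv_succ_apply_left]
      have h1 : HasFDerivAt (fun x => iteratedFDeriv ℝ (k + n) f x w)
          ((ContinuousMultilinearMap.apply ℝ (fun _ : Fin (k + n) => Fin d → ℝ) F w).comp
            (fderiv ℝ (iteratedFDeriv ℝ (k + n) f) x)) x :=
        (ContinuousMultilinearMap.apply ℝ (fun _ : Fin (k + n) => Fin d → ℝ) F w).hasFDerivAt.comp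
          x hd.hasFDerivAt
      simpa [partialDeriv] using (h1.hasLineDerivAt (Pi.single i 1)).lineDeriv

theorem norm_multiDeriv_le_norm_iteratedFDeriv {d : ℕ} {f : (Fin d → ℝ) → F}
    (hf : ContDiff ℝ ∞ f) (α : Fin d → ℕ) (x : Fin d → ℝ) :
    ‖multiDeriv α f x‖ ≤ ‖iteratedFDeriv ℝ (∑ i, α i) f x‖ := by
  have key : ∀ l : List (Fin d), ∃ w : Fin (l.map α).sum → Fin d → ℝ, (∀ j, ‖w j‖ ≤ 1) ∧
      ∀ x, l.foldr (fun i g => (partialDeriv i)^[α i] g) f x =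
        iteratedFDeriv ℝ (l.map α).sum f x w := by
    intro l
    induction l with
    | nil =>
      refine ⟨fun j => 0, fun j => by simp, fun x => ?_⟩
      exact (iteratedFDeriv_zero_apply (𝕜 := ℝ) (f := f) (x := x) _).symm
    | cons i l ih =>
      obtain ⟨w, hw, h⟩ := ih
      rw [List.map_cons, List.sum_cons]
      exact exists_partialDeriv_iterate_eq_iteratedFDeriv hf i (α i) hw h
  obtain ⟨w, hw, h⟩ := key (List.finRange d)
  have hs : ((List.finRange d).map α).sum = ∑ i, α i := by
    rw [← List.ofFn_eq_map, List.sum_ofFn]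
  rw [← hs, multiDeriv, h x]
  refine (ContinuousMultilinearMap.le_opNorm _ _).trans ?_
  exact mul_le_of_le_one_right (norm_nonneg _)
    (Finset.prod_le_one (fun _ _ => norm_nonneg _) fun j _ => hw j)

theorem UniformGevrey.isGevrey {d : ℕ} {s : ℝ} {f : (Fin d → ℝ) → F} (hf : UniformGevrey s f) :
    IsGevrey s f := by
  obtain ⟨hs, C, hC, A, hA, h⟩ := hf
  exact ⟨hs, fun K _ => ⟨C, hC, A, hA, fun x _ α =>
    (norm_multiDeriv_le_norm_iteratedFDeriv hs α x).trans (h _ x)⟩⟩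

theorem UniformGevrey.mono {s t : ℝ} (hst : s ≤ t) {f : E → F} (hf : UniformGevrey s f) :
    UniformGevrey t f := by
  obtain ⟨hs, C, hC, A, hA, h⟩ := hf
  refine ⟨hs, C, hC, A, hA, fun n x => (h n x).trans ?_⟩
  gcongr
  exact_mod_cast Nat.one_le_iff_ne_zero.2 (Nat.factorial_ne_zero n)

/-- The Leibniz formula keeps the Gevrey bounds because `i! (n - i)! ≤ n!`. -/
theorem UniformGevrey.mul {s : ℝ} (hs : 0 ≤ s) {f g : E → ℂ} (hf : UniformGevrey s f)
    (hg : UniformGevrey s g) : UniformGevrey s fun x => f x * g x := by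
  obtain ⟨hf0, C, hC, A, hA, hf⟩ := hf
  obtain ⟨hg0, D, hD, B, hB, hg⟩ := hg
  refine ⟨hf0.mul hg0, C * D, by positivity, A + B, by positivity, fun n x => ?_⟩
  refine (norm_iteratedFDeriv_mul_le hf0 hg0 x
    (by exact_mod_cast le_top : ((n : ℕ∞) : WithTop ℕ∞) ≤ ∞)).trans ?_
  rw [add_pow, Finset.mul_sum, Finset.sum_mul]
  refine Finset.sum_le_sum fun i hi => ?_
  have hin : i ≤ n := Nat.lt_succ_iff.1 (Finset.mem_range.1 hi)
  have hfac : (i ! : ℝ) ^ s * ((n - i)! : ℝ) ^ s ≤ (n ! : ℝ) ^ s := by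
    rw [← Real.mul_rpow (by positivity) (by positivity)]
    refine Real.rpow_le_rpow (by positivity) ?_ hs
    exact_mod_cast Nat.le_of_dvd (Nat.factorial_pos n)
      (Nat.factorial_mul_factorial_dvd_factorial hin)
  calc (n.choose i : ℝ) * ‖iteratedFDeriv ℝ i f x‖ * ‖iteratedFDeriv ℝ (n - i) g x‖
      ≤ (n.choose i : ℝ) * (C * A ^ i * (i ! : ℝ) ^ s) *
          (D * B ^ (n - i) * ((n - i)! : ℝ) ^ s) := by
        gcongr
        · exact hf i x
        · exact hg (n - i) x
    _ = C * D * (A ^ i * B ^ (n - i) * (n.choose i : ℝ)) *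
          ((i ! : ℝ) ^ s * ((n - i)! : ℝ) ^ s) := by ring
    _ ≤ _ := by gcongr

theorem UniformGevrey.comp_clm {s : ℝ} {f : E → F} (hf : UniformGevrey s f) (L : G →L[ℝ] E) :
    UniformGevrey s fun x => f (L x) := by
  obtain ⟨hs, C, hC, A, hA, h⟩ := hf
  refine ⟨hs.comp L.contDiff, C, hC, A * (‖L‖ + 1), by positivity, fun n x => ?_⟩
  have h1 : iteratedFDeriv ℝ n (fun x => f (L x)) x =
      (iteratedFDeriv ℝ n f (L x)).compContinuousLinearMap fun _ => L :=
    L.iteratedFDeriv_comp_right hs x (by exact_mod_cast le_top)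
  rw [h1]
  refine (ContinuousMultilinearMap.norm_compContinuousLinearMap_le _ _).trans ?_
  rw [Finset.prod_const, Finset.card_univ, Fintype.card_fin]
  calc ‖iteratedFDeriv ℝ n f (L x)‖ * ‖L‖ ^ n
      ≤ (C * A ^ n * (n ! : ℝ) ^ s) * (‖L‖ + 1) ^ n := by
        gcongr
        · exact h n _
        · linarith
    _ = _ := by rw [mul_pow]; ring

theorem UniformGevrey.clm_comp {s : ℝ} {f : E → F} (hf : UniformGevrey s f) (L : F →L[ℝ] G) :
    UniformGevrey s fun x => L (f x) := by
  obtain ⟨hs, C, hC, A, hA, h⟩ := hf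
  refine ⟨L.contDiff.comp hs, (‖L‖ + 1) * C, by positivity, A, hA, fun n x => ?_⟩
  refine (L.norm_iteratedFDeriv_comp_left (N := ∞) hs.contDiffAt
    (by exact_mod_cast le_top)).trans ?_
  calc ‖L‖ * ‖iteratedFDeriv ℝ n f x‖ ≤ (‖L‖ + 1) * (C * A ^ n * (n ! : ℝ) ^ s) := by
        gcongr
        · linarith
        · exact h n x
    _ = _ := by ring

theorem UniformGevrey.comp_add_right {s : ℝ} {f : E → F} (hf : UniformGevrey s f) (c : E) :
    UniformGevrey s fun x => f (x + c) := by
  obtain ⟨hs, C, hC, A, hA, h⟩ := hf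
  refine ⟨hs.comp (contDiff_id.add contDiff_const), C, hC, A, hA, fun n x => ?_⟩
  rw [iteratedFDeriv_comp_add_right]
  exact h n _

theorem UniformGevrey.sub {s : ℝ} {f g : E → F} (hf : UniformGevrey s f)
    (hg : UniformGevrey s g) : UniformGevrey s fun x => f x - g x := by
  obtain ⟨hf0, C, hC, A, hA, hf⟩ := hf
  obtain ⟨hg0, D, hD, B, hB, hg⟩ := hg
  refine ⟨hf0.sub hg0, C + D, by positivity, A + B, by positivity, fun n x => ?_⟩
  have h1 : iteratedFDeriv ℝ n (fun x => f x - g x) x =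
      iteratedFDeriv ℝ n f x - iteratedFDeriv ℝ n g x :=
    iteratedFDeriv_sub_apply (hf0.contDiffAt.of_le (by exact_mod_cast le_top))
      (hg0.contDiffAt.of_le (by exact_mod_cast le_top))
  rw [h1]
  calc _ ≤ ‖iteratedFDeriv ℝ n f x‖ + ‖iteratedFDeriv ℝ n g x‖ := norm_sub_le _ _
    _ ≤ C * A ^ n * (n ! : ℝ) ^ s + D * B ^ n * (n ! : ℝ) ^ s := add_le_add (hf n x) (hg n x)
    _ ≤ C * (A + B) ^ n * (n ! : ℝ) ^ s + D * (A + B) ^ n * (n ! : ℝ) ^ s := by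
        gcongr <;> linarith
    _ = _ := by ring

theorem uniformGevrey_of_iteratedDeriv {s : ℝ} {f : ℝ → F} (hs : ContDiff ℝ ∞ f) {C A : ℝ}
    (hC : 0 < C) (hA : 0 < A)
    (h : ∀ (n : ℕ) (x : ℝ), ‖iteratedDeriv n f x‖ ≤ C * A ^ n * (n ! : ℝ) ^ s) :
    UniformGevrey s f :=
  ⟨hs, C, hC, A, hA, fun n x => by
    rw [norm_iteratedFDeriv_eq_norm_iteratedDeriv]; exact h n x⟩

/-- A bounded antiderivative of a function with Gevrey bounds has Gevrey bounds. -/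
theorem UniformGevrey.of_hasDerivAt {s : ℝ} (hs : 0 ≤ s) {f g : ℝ → F} {M : ℝ}
    (hM : ∀ x, ‖f x‖ ≤ M) (hfg : ∀ x, HasDerivAt f (g x) x) (hg : UniformGevrey s g) :
    UniformGevrey s f := by
  obtain ⟨hg0, D, hD, B, hB, hg⟩ := hg
  have hder : deriv f = g := funext fun x => (hfg x).deriv
  have hM0 : 0 ≤ M := (norm_nonneg _).trans (hM 0)
  refine uniformGevrey_of_iteratedDeriv (C := M + D) (A := B + 1) ?_ (by positivity)
    (by positivity) fun n x => ?_
  · rw [contDiff_infty_iff_deriv, hder]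
    exact ⟨fun x => (hfg x).differentiableAt, hg0⟩
  · cases n with
    | zero =>
      simp only [iteratedDeriv_zero, pow_zero, mul_one, Nat.factorial_zero, Nat.cast_one,
        Real.one_rpow]
      linarith [hM x]
    | succ n =>
      rw [iteratedDeriv_succ', hder, ← norm_iteratedFDeriv_eq_norm_iteratedDeriv]
      refine (hg n x).trans ?_
      have h1 : (n ! : ℝ) ≤ ((n + 1)! : ℝ) := by exact_mod_cast Nat.factorial_le (Nat.le_succ n)
      have h2 : B ^ n ≤ (B + 1) ^ (n + 1) :=
        calc B ^ n ≤ (B + 1) ^ n := by gcongr; linarith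
          _ ≤ (B + 1) ^ (n + 1) := pow_le_pow_right₀ (by linarith) (Nat.le_succ n)
      gcongr
      linarith

end calculus

/-! ### Cauchy estimates on the real line -/

/-- On the real line the derivatives of the restriction of a holomorphic function are its complex
derivatives. -/
theorem iteratedDeriv_eq_of_eqOn_ofReal {U : Set ℂ} (hU : IsOpen U) {f : ℂ → ℂ}
    (hf : DifferentiableOn ℂ f U) {V : Set ℝ} (hV : IsOpen V) (hVU : ∀ x ∈ V, (x : ℂ) ∈ U)
    {g : ℝ → ℂ} (hg : ∀ x ∈ V, g x = f x) (n : ℕ) :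
    ∀ x ∈ V, iteratedDeriv n g x = iteratedDeriv n f x := by
  induction n with
  | zero => simpa using hg
  | succ n ih =>
    intro x hx
    have hd : DifferentiableAt ℂ (iteratedDeriv n f) x := by
      have : ContDiffAt ℂ ((n + 1 : ℕ) : WithTop ℕ∞) f x :=
        (hf.contDiffOn hU).contDiffAt (hU.mem_nhds (hVU x hx))
      rw [iteratedDeriv_eq_equiv_comp]
      exact (LinearIsometryEquiv.differentiable _).differentiableAt.comp _
        (this.differentiableAt_iteratedFDeriv (by exact_mod_cast Nat.lt_succ_self n))
    rw [iteratedDeriv_succ, iteratedDeriv_succ]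
    have he : iteratedDeriv n g =ᶠ[𝓝 x] fun y : ℝ => iteratedDeriv n f y := by
      filter_upwards [hV.mem_nhds hx] with y hy using ih y hy
    rw [he.deriv_eq]
    exact hd.hasDerivAt.comp_ofReal.deriv

theorem norm_iteratedDeriv_le_of_eqOn_ofReal {U : Set ℂ} (hU : IsOpen U) {f : ℂ → ℂ}
    (hf : DifferentiableOn ℂ f U) {V : Set ℝ} (hV : IsOpen V) (hVU : ∀ x ∈ V, (x : ℂ) ∈ U)
    {g : ℝ → ℂ} (hg : ∀ x ∈ V, g x = f x) (n : ℕ) {x R C : ℝ} (hx : x ∈ V) (hR : 0 < R)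
    (hRU : Metric.closedBall (x : ℂ) R ⊆ U) (hC : ∀ z ∈ Metric.sphere (x : ℂ) R, ‖f z‖ ≤ C) :
    ‖iteratedDeriv n g x‖ ≤ n ! * C / R ^ n := by
  rw [iteratedDeriv_eq_of_eqOn_ofReal hU hf hV hVU hg n x hx]
  refine Complex.norm_iteratedDeriv_le_of_forall_mem_sphere_norm_le n hR ?_ hC
  exact (hf.mono hRU).diffContOnCl_ball subset_rfl

theorem pow_le_mul_factorial_mul_exp (n : ℕ) {x : ℝ} (hx : 0 ≤ x) :
    x ^ n ≤ n ! * Real.exp x := by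
  have := Real.pow_div_factorial_le_exp x hx n
  rwa [div_le_iff₀ (by positivity), mul_comm] at this

/-- The function `e^{-1/x}`, `x > 0`, extended by zero, has Gevrey bounds of order `2`: apply the
Cauchy estimate on the disc of centre `x` and radius `x / 2`. -/
theorem uniformGevrey_expNegInvGlue :
    UniformGevrey 2 fun x : ℝ => (expNegInvGlue x : ℂ) := by
  have hsm : ContDiff ℝ ∞ fun x : ℝ => (expNegInvGlue x : ℂ) :=
    Complex.ofRealCLM.contDiff.comp expNegInvGlue.contDiff
  refine uniformGevrey_of_iteratedDeriv (C := 1) (A := 9) hsm one_pos (by norm_num)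
    fun n x => ?_
  rw [one_mul]
  have hcont : Continuous fun x : ℝ => ‖iteratedDeriv n (fun x : ℝ => (expNegInvGlue x : ℂ)) x‖ :=
    (hsm.continuous_iteratedDeriv n (by exact_mod_cast le_top)).norm
  have hne : ∀ x ∈ ({0}ᶜ : Set ℝ),
      ‖iteratedDeriv n (fun x : ℝ => (expNegInvGlue x : ℂ)) x‖ ≤ 9 ^ n * (n ! : ℝ) ^ (2 : ℝ) := by
    intro x hx
    rcases lt_or_gt_of_ne (show x ≠ 0 from hx) with hx | hx
    · have he : (fun x : ℝ => (expNegInvGlue x : ℂ)) =ᶠ[𝓝 x] fun _ => 0 := by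
        filter_upwards [Iio_mem_nhds hx] with y hy
        simp [expNegInvGlue.zero_of_nonpos (le_of_lt hy)]
      rw [he.iteratedDeriv_eq]
      simp only [iteratedDeriv_const]
      split_ifs <;> simp
    · have hU : IsOpen {z : ℂ | 0 < z.re} := isOpen_lt continuous_const Complex.continuous_re
      have hball : Metric.closedBall (x : ℂ) (x / 2) ⊆
          {z : ℂ | x / 2 ≤ z.re ∧ ‖z‖ ≤ 3 * x / 2} := by
        intro z hz
        rw [Metric.mem_closedBall, dist_eq_norm] at hz
        constructor
        · have := (Complex.abs_re_le_norm (z - x)).trans hz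
          rw [abs_le, Complex.sub_re, Complex.ofReal_re] at this
          linarith [this.1]
        · have h2 : ‖z‖ ≤ ‖z - x‖ + ‖(x : ℂ)‖ := by simpa using norm_add_le (z - x) (x : ℂ)
          rw [Complex.norm_real, Real.norm_of_nonneg hx.le] at h2
          linarith
      have hb := norm_iteratedDeriv_le_of_eqOn_ofReal (f := fun z => Complex.exp (-z⁻¹))
        (g := fun x : ℝ => (expNegInvGlue x : ℂ)) (V := Ioi 0) (x := x) (R := x / 2)
        (C := Real.exp (-(2 / (9 * x)))) hU ?_ isOpen_Ioi ?_ ?_ n hx (by positivity) ?_ ?_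
      · refine hb.trans ?_
        have h3 := pow_le_mul_factorial_mul_exp n (x := 2 / (9 * x)) (by positivity)
        have h4 : (n ! : ℝ) ^ (2 : ℝ) = n ! * n ! := by
          rw [Real.rpow_two, sq]
        have h5 : (2 / (9 * x)) ^ n * Real.exp (-(2 / (9 * x))) ≤ n ! := by
          calc _ ≤ (n ! * Real.exp (2 / (9 * x))) * Real.exp (-(2 / (9 * x))) := by gcongr
            _ = n ! := by rw [mul_assoc, ← Real.exp_add]; simp
        have h6 : ((x / 2) ^ n)⁻¹ = 9 ^ n * (2 / (9 * x)) ^ n := by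
          rw [← mul_pow, ← inv_pow]; congr 1; field_simp
        rw [div_eq_mul_inv, h6, h4]
        calc n ! * Real.exp (-(2 / (9 * x))) * (9 ^ n * (2 / (9 * x)) ^ n)
            = 9 ^ n * n ! * ((2 / (9 * x)) ^ n * Real.exp (-(2 / (9 * x)))) := by ring
          _ ≤ 9 ^ n * n ! * n ! := by gcongr
          _ = _ := by ring
      · intro z hz
        have hz0 : z ≠ 0 := fun h => by simp [h] at hz
        exact ((differentiableAt_inv hz0).neg.cexp).differentiableWithinAt
      · intro y hy; simpa using hy
      · intro y hy
        have hy' : ¬ y ≤ 0 := not_le.2 hy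
        simp [expNegInvGlue, hy']
      · exact hball.trans fun z hz => lt_of_lt_of_le (by positivity) hz.1
      · intro z hz
        obtain ⟨h1, h2⟩ := hball (Metric.sphere_subset_closedBall hz)
        have hz0 : 0 < ‖z‖ := lt_of_lt_of_le (by positivity) (h1.trans (Complex.re_le_norm z))
        rw [Complex.norm_exp, Complex.neg_re, Complex.inv_re, Complex.normSq_eq_norm_sq]
        refine Real.exp_le_exp.2 (neg_le_neg ?_)
        rw [div_le_div_iff₀ (by positivity) (by positivity)]
        have h7 : ‖z‖ ^ 2 ≤ (3 * x / 2) ^ 2 := by gcongr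
        nlinarith
  -- The bound extends to the origin by continuity of the derivatives.
  have hd : Dense ({0}ᶜ : Set ℝ) := dense_compl_singleton 0
  exact (isClosed_le hcont continuous_const).closure_subset_iff.2 hne (hd x)

/-- The Gaussian `e^{-y²}` has analytic bounds, by the Cauchy estimate on discs of radius `1`. -/
theorem uniformGevrey_gaussian :
    UniformGevrey 1 fun y : ℝ => Complex.exp (-(y : ℂ) ^ 2) := by
  have hsm : ContDiff ℝ ∞ fun y : ℝ => Complex.exp (-(y : ℂ) ^ 2) :=
    ((Complex.ofRealCLM.contDiff.pow 2).neg).cexp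
  refine uniformGevrey_of_iteratedDeriv (C := Real.exp 1) (A := 1) hsm (by positivity) one_pos
    fun n x => ?_
  have hb := norm_iteratedDeriv_le_of_eqOn_ofReal (f := fun z => Complex.exp (-z ^ 2))
    (g := fun y : ℝ => Complex.exp (-(y : ℂ) ^ 2)) (U := univ) (V := univ) (x := x) (R := 1)
    (C := Real.exp 1) isOpen_univ (by fun_prop) isOpen_univ (by simp) (by simp) n (by simp)
    one_pos (subset_univ _) ?_
  · refine hb.trans (le_of_eq ?_)
    simp [mul_comm]
  · intro z hz
    rw [Complex.norm_exp]
    refine Real.exp_le_exp.2 ?_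
    have h1 := Complex.abs_im_le_norm (z - x)
    rw [mem_sphere_iff_norm.1 hz, Complex.sub_im, Complex.ofReal_im, sub_zero] at h1
    simp only [Complex.neg_re, pow_two, Complex.mul_re]
    nlinarith [abs_le.1 h1, sq_nonneg z.re, sq_abs z.im, abs_nonneg z.im]

/-! ### The initial data -/

/-- A compactly supported Gevrey cutoff of order `2`, equal to `1` on `[-1, 1]`: a difference of
translates of an antiderivative of a bump function. -/
theorem exists_gevrey_cutoff : ∃ χ : ℝ → ℂ, UniformGevrey 2 χ ∧ (∀ y, |y| ≤ 1 → χ y = 1) ∧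
    ∀ y, 3 ≤ |y| → χ y = 0 := by
  -- `ψ` is supported in `[-1, 1]`, and its antiderivative `Ψ` is constant outside `[-1, 1]`.
  set ψ : ℝ → ℝ := fun y => expNegInvGlue (1 + y) * expNegInvGlue (1 - y) with hψ
  have hψc : Continuous ψ := by
    have := (expNegInvGlue.contDiff (n := 0)).continuous
    exact (this.comp (by fun_prop)).mul (this.comp (by fun_prop))
  have hψi : ∀ u v, IntervalIntegrable ψ volume u v := fun u v => hψc.intervalIntegrable u v
  have hψ0 : ∀ y, 0 ≤ ψ y := fun y => mul_nonneg (expNegInvGlue.nonneg _) (expNegInvGlue.nonneg _)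
  have hψl : ∀ y, y ≤ -1 → ψ y = 0 := fun y hy => by
    simp [hψ, expNegInvGlue.zero_of_nonpos (show 1 + y ≤ 0 by linarith)]
  have hψr : ∀ y, 1 ≤ y → ψ y = 0 := fun y hy => by
    simp [hψ, expNegInvGlue.zero_of_nonpos (show 1 - y ≤ 0 by linarith)]
  set Ψ : ℝ → ℝ := fun y => ∫ z in (-1 : ℝ)..y, ψ z with hΨ
  set m : ℝ := Ψ 1 with hm
  have hmpos : 0 < m := by
    refine intervalIntegral.intervalIntegral_pos_of_pos_on (hψi _ _) (fun y hy => ?_) (by norm_num)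
    exact mul_pos (expNegInvGlue.pos_of_pos (by linarith [hy.1]))
      (expNegInvGlue.pos_of_pos (by linarith [hy.2]))
  have hΨl : ∀ y, y ≤ -1 → Ψ y = 0 := fun y hy => by
    rw [hΨ]
    simp only
    rw [intervalIntegral.integral_symm, neg_eq_zero]
    refine intervalIntegral.integral_zero_ae (Eventually.of_forall fun z hz => hψl z ?_)
    rw [uIoc_of_le hy] at hz
    exact hz.2
  have hΨr : ∀ y, 1 ≤ y → Ψ y = m := fun y hy => by
    have h1 : Ψ y = m + ∫ z in (1 : ℝ)..y, ψ z :=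
      (intervalIntegral.integral_add_adjacent_intervals (hψi _ _) (hψi _ _)).symm
    rw [h1, add_eq_left]
    refine intervalIntegral.integral_zero_ae (Eventually.of_forall fun z hz => hψr z ?_)
    rw [uIoc_of_le hy] at hz
    exact hz.1.le
  have hmono : Monotone Ψ := fun u v huv => by
    have h1 : Ψ v = Ψ u + ∫ z in u..v, ψ z :=
      (intervalIntegral.integral_add_adjacent_intervals (hψi _ _) (hψi _ _)).symm
    rw [h1]
    linarith [intervalIntegral.integral_nonneg (μ := volume) huv fun z _ => hψ0 z]
  have hbound : ∀ y, ‖(Ψ y : ℂ)‖ ≤ m := fun y => by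
    have h0 : 0 ≤ Ψ y := by
      rcases le_total y (-1) with h | h
      · exact (hΨl y h).ge
      · exact (hΨl (-1) le_rfl).ge.trans (hmono h)
    rw [Complex.norm_real, Real.norm_of_nonneg h0]
    rcases le_total y 1 with h | h
    · exact hmono h
    · exact (hΨr y h).le
  have hψG : UniformGevrey 2 fun y : ℝ => (ψ y : ℂ) := by
    have h1 := uniformGevrey_expNegInvGlue.comp_add_right 1
    have h2 := h1.comp_clm (-(ContinuousLinearMap.id ℝ ℝ))
    have h3 := h1.mul (by norm_num) h2
    convert h3 using 2 with y
    simp [hψ, add_comm, sub_eq_add_neg]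
  have hΨG : UniformGevrey 2 fun y : ℝ => (Ψ y : ℂ) :=
    UniformGevrey.of_hasDerivAt (by norm_num) hbound
      (fun y => (hψc.integral_hasStrictDerivAt (-1) y).hasDerivAt.ofReal_comp) hψG
  have hdiff := ((hΨG.comp_add_right 2).sub (hΨG.comp_add_right (-2))).clm_comp
    ((m : ℝ)⁻¹ • ContinuousLinearMap.id ℝ ℂ)
  refine ⟨_, hdiff, fun y hy => ?_, fun y hy => ?_⟩
  · rw [abs_le] at hy
    have h1 : Ψ (y + 2) = m := hΨr _ (by linarith)
    have h2 : Ψ (y + -2) = 0 := hΨl _ (by linarith)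
    have hm' : (m : ℂ) ≠ 0 := by exact_mod_cast hmpos.ne'
    simp [h1, h2, hm']
  · rcases le_abs.1 hy with h | h
    · simp [hΨr (y + 2) (by linarith), hΨr (y + -2) (by linarith)]
    · simp [hΨl (y + 2) (by linarith), hΨl (y + -2) (by linarith)]

theorem iteratedDeriv_cexp_mul_ofReal (c : ℂ) (n : ℕ) :
    iteratedDeriv n (fun y : ℝ => Complex.exp (c * y)) =
      fun y : ℝ => c ^ n * Complex.exp (c * y) := by
  induction n with
  | zero => simp
  | succ n ih =>
    rw [iteratedDeriv_succ, ih]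
    funext y
    have h1 : HasDerivAt (fun y : ℝ => c * (y : ℂ)) c y := by
      simpa using (Complex.ofRealCLM.hasDerivAt (x := y)).const_mul c
    rw [(h1.cexp.const_mul (c ^ n)).deriv]
    ring

/-- The exponential series with frequencies `ε j ^ s` and coefficients `e^{-2j}`. Frequency `±η`
has amplitude `e^{-2 η^{1/s}}`, which is why it is of Gevrey order `s`. -/
def gevreySeries (ε s : ℝ) (y : ℝ) : ℂ :=
  ∑' j : ℕ, Real.exp (-2 * j) * Complex.exp (Complex.I * ((ε * (j : ℝ) ^ s : ℝ) : ℂ) * y)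

theorem summable_exp_neg_nat : Summable fun j : ℕ => Real.exp (-(j : ℝ)) := by
  simpa using Real.summable_exp_neg_nat

/-- This is `x ^ n ≤ n! e^x` for `x = j / s`, raised to the power `s`. -/
theorem nat_rpow_pow_mul_exp_le {s : ℝ} (hs : 0 < s) (n j : ℕ) :
    Real.exp (-2 * j) * ((j : ℝ) ^ s) ^ n ≤ (s ^ s) ^ n * (n ! : ℝ) ^ s * Real.exp (-(j : ℝ)) := by
  have h1 : ((j : ℝ) ^ s) ^ n = ((j : ℝ) ^ n) ^ s := by
    rw [← Real.rpow_natCast, ← Real.rpow_natCast, ← Real.rpow_mul (by positivity),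
      ← Real.rpow_mul (by positivity), mul_comm]
  have h2 : (s ^ s) ^ n = (s ^ n) ^ s := by
    rw [← Real.rpow_natCast, ← Real.rpow_natCast, ← Real.rpow_mul hs.le,
      ← Real.rpow_mul hs.le, mul_comm]
  have h3 : (j : ℝ) ^ n ≤ s ^ n * (n ! * Real.exp (j / s)) := by
    have := pow_le_mul_factorial_mul_exp n (x := (j : ℝ) / s) (by positivity)
    rw [div_pow, div_le_iff₀ (by positivity)] at this
    linarith
  have h4 : ((j : ℝ) ^ n) ^ s ≤ (s ^ n) ^ s * ((n ! : ℝ) ^ s * Real.exp j) := by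
    refine (Real.rpow_le_rpow (by positivity) h3 hs.le).trans (le_of_eq ?_)
    rw [Real.mul_rpow (by positivity) (by positivity), Real.mul_rpow (by positivity)
      (by positivity), ← Real.exp_mul, div_mul_cancel₀ _ hs.ne']
  rw [h1, h2]
  have h5 : Real.exp (-(j : ℝ)) = Real.exp (-2 * j) * Real.exp j := by
    rw [← Real.exp_add]; congr 1; ring
  rw [h5]
  calc _ ≤ Real.exp (-2 * j) * ((s ^ n) ^ s * ((n ! : ℝ) ^ s * Real.exp j)) := by gcongr
    _ = _ := by ring

theorem norm_iteratedDeriv_gevreySeries_term_le {ε s : ℝ} (hε : |ε| = 1) (hs : 0 < s)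
    (n j : ℕ) (y : ℝ) :
    ‖iteratedFDeriv ℝ n (fun y : ℝ => (Real.exp (-2 * j) : ℂ) *
      Complex.exp (Complex.I * ((ε * (j : ℝ) ^ s : ℝ) : ℂ) * y)) y‖ ≤
      (s ^ s) ^ n * (n ! : ℝ) ^ s * Real.exp (-(j : ℝ)) := by
  rw [norm_iteratedFDeriv_eq_norm_iteratedDeriv, iteratedDeriv_const_mul_field,
    iteratedDeriv_cexp_mul_ofReal]
  refine le_trans (le_of_eq ?_) (nat_rpow_pow_mul_exp_le hs n j)
  have h1 : ‖Complex.exp (Complex.I * ((ε * (j : ℝ) ^ s : ℝ) : ℂ) * y)‖ = 1 := by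
    have : Complex.I * ((ε * (j : ℝ) ^ s : ℝ) : ℂ) * y =
        ((ε * (j : ℝ) ^ s * y : ℝ) : ℂ) * Complex.I := by push_cast; ring
    rw [this, Complex.norm_exp_ofReal_mul_I]
  simp only [norm_mul, h1, norm_pow, Complex.norm_I, Complex.norm_real, Real.norm_eq_abs, hε,
    one_mul, mul_one, Real.abs_exp]
  rw [abs_of_nonneg (by positivity : (0 : ℝ) ≤ (j : ℝ) ^ s)]

theorem uniformGevrey_gevreySeries {ε s : ℝ} (hε : |ε| = 1) (hs : 0 < s) :
    UniformGevrey s (gevreySeries ε s) := by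
  have hsum : ∀ n : ℕ, Summable fun j : ℕ =>
      (s ^ s) ^ n * (n ! : ℝ) ^ s * Real.exp (-(j : ℝ)) :=
    fun n => summable_exp_neg_nat.mul_left _
  have hsm : ∀ j : ℕ, ContDiff ℝ ∞ (fun y : ℝ => (Real.exp (-2 * j) : ℂ) *
      Complex.exp (Complex.I * ((ε * (j : ℝ) ^ s : ℝ) : ℂ) * y)) := fun j =>
    contDiff_const.mul (contDiff_const.mul Complex.ofRealCLM.contDiff).cexp
  refine ⟨contDiff_tsum (N := ⊤) hsm (fun n _ => hsum n)
      fun n j y _ => norm_iteratedDeriv_gevreySeries_term_le hε hs n j y,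
    ∑' j : ℕ, Real.exp (-(j : ℝ)), summable_exp_neg_nat.tsum_pos (fun _ => by positivity) 0
      (by positivity), s ^ s, by positivity, fun n y => ?_⟩
  have h1 : iteratedFDeriv ℝ n (gevreySeries ε s) y = ∑' j : ℕ, iteratedFDeriv ℝ n
      (fun y : ℝ => (Real.exp (-2 * j) : ℂ) *
        Complex.exp (Complex.I * ((ε * (j : ℝ) ^ s : ℝ) : ℂ) * y)) y :=
    iteratedFDeriv_tsum_apply (N := ⊤) hsm (fun n _ => hsum n)
      (fun n j y _ => norm_iteratedDeriv_gevreySeries_term_le hε hs n j y) le_top y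
  rw [h1]
  refine (tsum_of_norm_bounded (hsum n).hasSum
    fun j => norm_iteratedDeriv_gevreySeries_term_le hε hs n j y).trans (le_of_eq ?_)
  rw [tsum_mul_left]
  ring

/-- The one-dimensional profile of the initial data: a Gaussian times `gevreySeries`. Its Fourier
transform is a positive combination of Gaussians. -/
def profile (ε s : ℝ) (y : ℝ) : ℂ :=
  Complex.exp (-(y : ℂ) ^ 2) * gevreySeries ε s y

theorem uniformGevrey_profile {ε s : ℝ} (hε : |ε| = 1) (hs : 1 ≤ s) :
    UniformGevrey s (profile ε s) :=
  (uniformGevrey_gaussian.mono hs).mul (by linarith)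
    (uniformGevrey_gevreySeries hε (by linarith))

theorem exists_isGevreyCompact_data {ε s : ℝ} (hε : |ε| = 1) (hs : 2 ≤ s) :
    ∃ U₀ : (Fin 2 → ℝ) → (Fin 3 → ℂ), IsGevreyCompact s U₀ ∧
      ∀ x y : ℝ, |x| ≤ 1 → |y| ≤ 1 → U₀ ![x, y] = ![profile ε s y, 0, 0] := by
  obtain ⟨χ, hχ, hχ1, hχ0⟩ := exists_gevrey_cutoff
  have hx := (hχ.mono hs).comp_clm (ContinuousLinearMap.proj 0 : (Fin 2 → ℝ) →L[ℝ] ℝ)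
  have hy := (((hχ.mono hs).mul (by linarith) (uniformGevrey_profile hε (by linarith)))).comp_clm
    (ContinuousLinearMap.proj 1 : (Fin 2 → ℝ) →L[ℝ] ℝ)
  have hu := (hx.mul (by linarith) hy).clm_comp
    (ContinuousLinearMap.single ℝ (fun _ : Fin 3 => ℂ) 0)
  refine ⟨_, ⟨hu.isGevrey, ?_⟩, fun x y hx hy => ?_⟩
  · refine HasCompactSupport.of_support_subset_isCompact
      (isCompact_Icc (a := fun _ : Fin 2 => (-3 : ℝ)) (b := fun _ => 3)) fun p hp => ?_
    have h : ∀ i, |p i| < 3 := by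
      intro i
      by_contra! hi
      apply hp
      fin_cases i
      · simp [hχ0 (p 0) hi]
      · simp [hχ0 (p 1) hi]
    exact ⟨fun i => (abs_lt.1 (h i)).1.le, fun i => (abs_lt.1 (h i)).2.le⟩
  · ext i
    fin_cases i <;> simp [hχ1 x hx, hχ1 y hy]

/-! ### Green's identity on a box -/

/-- The adjoint system `(∂_t + Aᵀ ∂_x + x Bᵀ ∂_y) Φ = 0`, for an everywhere differentiable `Φ`. -/
def IsAdjointSolution (a : ℂ) (Φ : Fin 3 → (Fin 3 → ℝ) → ℂ) : Prop :=
  ∀ p : Fin 3 → ℝ, ∃ D : Fin 3 → (Fin 3 → ℝ) →L[ℝ] ℂ, (∀ i, HasFDerivAt (Φ i) (D i) p) ∧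
    D 0 (Pi.single 0 1) + D 1 (Pi.single 1 1)
      + p 1 * (-a * D 1 (Pi.single 2 1) + (1 + a ^ 2) * D 2 (Pi.single 2 1)) = 0 ∧
    D 1 (Pi.single 0 1) + D 0 (Pi.single 1 1) + p 1 * (a * D 0 (Pi.single 2 1)) = 0 ∧
    D 2 (Pi.single 0 1) + p 1 * D 0 (Pi.single 2 1) = 0

/-- The flux, in the three coordinate directions, of the pairing of `U` with `Φ`. -/
def flux (a : ℂ) (U : (Fin 3 → ℝ) → (Fin 3 → ℂ)) (Φ : Fin 3 → (Fin 3 → ℝ) → ℂ) :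
    Fin 3 → (Fin 3 → ℝ) → ℂ :=
  ![fun p => U p 0 * Φ 0 p + U p 1 * Φ 1 p + U p 2 * Φ 2 p,
    fun p => U p 1 * Φ 0 p + U p 0 * Φ 1 p,
    fun p => p 1 * ((a * U p 1 + U p 2) * Φ 0 p + (-a * U p 0) * Φ 1 p
      + (1 + a ^ 2) * U p 0 * Φ 2 p)]

theorem opL_eq_zero_iff {a : ℂ} {U : (Fin 3 → ℝ) → (Fin 3 → ℂ)} {p : Fin 3 → ℝ}
    (hU : DifferentiableAt ℝ U p) : opL a U p = 0 ↔
      fderiv ℝ U p (Pi.single 0 1) 0 + fderiv ℝ U p (Pi.single 1 1) 1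
        + p 1 * (a * fderiv ℝ U p (Pi.single 2 1) 1 + fderiv ℝ U p (Pi.single 2 1) 2) = 0 ∧
      fderiv ℝ U p (Pi.single 0 1) 1 + fderiv ℝ U p (Pi.single 1 1) 0
        + p 1 * (-a * fderiv ℝ U p (Pi.single 2 1) 0) = 0 ∧
      fderiv ℝ U p (Pi.single 0 1) 2
        + p 1 * ((1 + a ^ 2) * fderiv ℝ U p (Pi.single 2 1) 0) = 0 := by
  have h : ∀ i, partialDeriv i U p = fderiv ℝ U p (Pi.single i 1) := fun i =>
    hU.lineDeriv_eq_fderiv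
  rw [opL, h, h, h, funext_iff, Fin.forall_fin_succ, Fin.forall_fin_succ, Fin.forall_fin_one]
  simp [matA, matB, dotProduct, Fin.sum_univ_three, Matrix.vecHead, Matrix.vecTail,
    Fin.succ_zero_eq_one,
    Fin.succ_one_eq_two]

/-- The flux of a solution against an adjoint solution is divergence free. -/
theorem exists_hasFDerivAt_flux {a : ℂ} {U : (Fin 3 → ℝ) → (Fin 3 → ℂ)}
    {Φ : Fin 3 → (Fin 3 → ℝ) → ℂ} (hΦ : IsAdjointSolution a Φ) {p : Fin 3 → ℝ}
    (hU : DifferentiableAt ℝ U p) (hL : opL a U p = 0) :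
    ∃ F' : Fin 3 → (Fin 3 → ℝ) →L[ℝ] ℂ, (∀ i, HasFDerivAt (flux a U Φ i) (F' i) p) ∧
      ∑ i, F' i (Pi.single i 1) = 0 := by
  obtain ⟨D, hD, h1, h2, h3⟩ := hΦ p
  obtain ⟨e1, e2, e3⟩ := (opL_eq_zero_iff hU).1 hL
  have hUi : ∀ i, HasFDerivAt (fun p => U p i)
      ((ContinuousLinearMap.proj i : (Fin 3 → ℂ) →L[ℝ] ℂ).comp (fderiv ℝ U p)) p := fun i =>
    hasFDerivAt_pi'.1 hU.hasFDerivAt i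
  have hx : HasFDerivAt (fun p : Fin 3 → ℝ => ((p 1 : ℝ) : ℂ))
      (Complex.ofRealCLM.comp (ContinuousLinearMap.proj 1 : (Fin 3 → ℝ) →L[ℝ] ℝ)) p :=
    (Complex.ofRealCLM.comp (ContinuousLinearMap.proj 1 : (Fin 3 → ℝ) →L[ℝ] ℝ)).hasFDerivAt
  have hF0 : HasFDerivAt (flux a U Φ 0) _ p :=
    (((hUi 0).mul (hD 0)).add ((hUi 1).mul (hD 1))).add ((hUi 2).mul (hD 2))
  have hF1 : HasFDerivAt (flux a U Φ 1) _ p := ((hUi 1).mul (hD 0)).add ((hUi 0).mul (hD 1))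
  have hF2 : HasFDerivAt (flux a U Φ 2) _ p :=
    hx.mul ((((((hUi 1).const_mul a).add (hUi 2)).mul (hD 0)).add
      (((hUi 0).const_mul (-a)).mul (hD 1))).add (((hUi 0).const_mul (1 + a ^ 2)).mul (hD 2)))
  refine ⟨fun i => fderiv ℝ (flux a U Φ i) p, fun i => ?_, ?_⟩
  · fin_cases i
    · exact hF0.differentiableAt.hasFDerivAt
    · exact hF1.differentiableAt.hasFDerivAt
    · exact hF2.differentiableAt.hasFDerivAt
  · rw [Fin.sum_univ_three]
    beta_reduce
    rw [hF0.fderiv, hF1.fderiv, hF2.fderiv]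
    simp
    linear_combination U p 0 * h1 + U p 1 * h2 + U p 2 * h3 + Φ 0 p * e1 + Φ 1 p * e2 + Φ 2 p * e3

/-- The box `[0, T] × [-r, r]²`. -/
def box (T r : ℝ) : Set (Fin 3 → ℝ) := Icc ![0, -r, -r] ![T, r, r]

theorem mem_box {T r : ℝ} {p : Fin 3 → ℝ} :
    p ∈ box T r ↔ (0 ≤ p 0 ∧ p 0 ≤ T) ∧ |p 1| ≤ r ∧ |p 2| ≤ r := by
  simp only [box, mem_Icc, Pi.le_def, Fin.forall_fin_succ, abs_le]
  simp [Fin.succ_zero_eq_one, Fin.succ_one_eq_two]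
  tauto

/-- If an adjoint solution is bounded by `N` on the top and on the sides of a box, then its pairing
with the Cauchy data on the bottom is `O(N)`, with a constant that depends only on the solution
`U` and on the box. -/
theorem exists_norm_pairing_le {a : ℂ} {Ω : Set (Fin 3 → ℝ)} (hΩ : IsOpen Ω)
    {U : (Fin 3 → ℝ) → (Fin 3 → ℂ)} (hU : ContDiffOn ℝ 1 U Ω) (hL : ∀ p ∈ Ω, opL a U p = 0)
    {T r : ℝ} (hT : 0 ≤ T) (hr : 0 ≤ r) (hbox : box T r ⊆ Ω) :
    ∃ C : ℝ, 0 ≤ C ∧ ∀ (Φ : Fin 3 → (Fin 3 → ℝ) → ℂ) (N : ℝ), IsAdjointSolution a Φ → 0 ≤ N →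
      (∀ p ∈ box T r, p 0 = T ∨ |p 1| = r ∨ |p 2| = r → ∀ i, ‖Φ i p‖ ≤ N) →
      ‖∫ q in Icc (fun _ : Fin 2 => -r) (fun _ => r), ∑ i, U ![0, q 0, q 1] i * Φ i ![0, q 0, q 1]‖
        ≤ C * N := by
  have hUc : ContinuousOn U (box T r) := hU.continuousOn.mono hbox
  obtain ⟨M, hM⟩ := isCompact_Icc.exists_bound_of_continuousOn hUc
  have hM0 : 0 ≤ M := (norm_nonneg _).trans
    (hM ![0, 0, 0] (mem_box.2 (by simp [hT, hr])))
  have hMi : ∀ p ∈ box T r, ∀ i, ‖U p i‖ ≤ M := fun p hp i => (norm_le_pi_norm _ i).trans (hM p hp)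
  set c : ℝ := 3 + r * (‖a‖ + 1 + ‖a‖ + ‖1 + a ^ 2‖) with hc
  have hc0 : 0 ≤ c := by positivity
  set lo : Fin 3 → ℝ := ![0, -r, -r] with hlo
  set hi : Fin 3 → ℝ := ![T, r, r] with hhi
  have hle : lo ≤ hi := by
    intro i; fin_cases i <;> simp [hlo, hhi, hT] <;> linarith
  set v : Fin 3 → ℝ := fun i => volume.real (Icc (lo ∘ i.succAbove) (hi ∘ i.succAbove)) with hv
  have hv0 : ∀ i, 0 ≤ v i := fun i => measureReal_nonneg
  refine ⟨(v 0 + 2 * v 1 + 2 * v 2) * (c * M),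
    by have := hv0 0; have := hv0 1; have := hv0 2; positivity,
    fun Φ N hΦ hN hb => ?_⟩
  have hUd : ∀ p ∈ Ω, DifferentiableAt ℝ U p := fun p hp =>
    (hU.contDiffAt (hΩ.mem_nhds hp)).differentiableAt (by norm_num)
  have hflux : ∀ p ∈ box T r, (p 0 = T ∨ |p 1| = r ∨ |p 2| = r) → ∀ i,
      ‖flux a U Φ i p‖ ≤ c * M * N := by
    intro p hp hp' i
    have h1 : |p 1| ≤ r := (mem_box.1 hp).2.1
    have hMp := hMi p hp
    have hNp := hb p hp hp'
    have hm : ∀ i j, ‖U p i * Φ j p‖ ≤ M * N := fun i j => by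
      rw [norm_mul]; exact mul_le_mul (hMp i) (hNp j) (norm_nonneg _) hM0
    have hMN : 0 ≤ M * N := by positivity
    have hc3 : 3 * (M * N) ≤ c * M * N := by
      rw [hc, mul_assoc]
      gcongr
      have : 0 ≤ r * (‖a‖ + 1 + ‖a‖ + ‖1 + a ^ 2‖) := by positivity
      linarith
    fin_cases i
    · refine le_trans ?_ hc3
      change ‖U p 0 * Φ 0 p + U p 1 * Φ 1 p + U p 2 * Φ 2 p‖ ≤ _
      refine (norm_add₃_le).trans ?_
      linarith [hm 0 0, hm 1 1, hm 2 2]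
    · refine le_trans ?_ hc3
      change ‖U p 1 * Φ 0 p + U p 0 * Φ 1 p‖ ≤ _
      refine (norm_add_le _ _).trans ?_
      linarith [hm 1 0, hm 0 1]
    · change ‖(p 1 : ℂ) * ((a * U p 1 + U p 2) * Φ 0 p + (-a * U p 0) * Φ 1 p
        + (1 + a ^ 2) * U p 0 * Φ 2 p)‖ ≤ _
      have h2 : (a * U p 1 + U p 2) * Φ 0 p + (-a * U p 0) * Φ 1 p + (1 + a ^ 2) * U p 0 * Φ 2 p
          = a * (U p 1 * Φ 0 p) + U p 2 * Φ 0 p + -a * (U p 0 * Φ 1 p)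
            + (1 + a ^ 2) * (U p 0 * Φ 2 p) := by ring
      have h3 : ‖(a * U p 1 + U p 2) * Φ 0 p + (-a * U p 0) * Φ 1 p
          + (1 + a ^ 2) * U p 0 * Φ 2 p‖ ≤ (‖a‖ + 1 + ‖a‖ + ‖1 + a ^ 2‖) * (M * N) := by
        rw [h2]
        refine (norm_add_le _ _).trans ?_
        refine (add_le_add_left (norm_add₃_le) _).trans ?_
        rw [norm_mul a, norm_mul (-a), norm_neg, norm_mul (1 + a ^ 2)]
        have e1 := mul_le_mul_of_nonneg_left (hm 1 0) (norm_nonneg a)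
        have e2 := mul_le_mul_of_nonneg_left (hm 0 1) (norm_nonneg a)
        have e3 := mul_le_mul_of_nonneg_left (hm 0 2) (norm_nonneg (1 + a ^ 2))
        linarith [hm 2 0]
      rw [norm_mul, Complex.norm_real, Real.norm_eq_abs]
      calc |p 1| * _ ≤ r * ((‖a‖ + 1 + ‖a‖ + ‖1 + a ^ 2‖) * (M * N)) := by gcongr
        _ ≤ c * M * N := by rw [hc]; linarith
  have hdiv := integral_divergence_of_hasFDerivAt_off_countable' lo hi hle (flux a U Φ)
    (fun i p => fderiv ℝ (flux a U Φ i) p) ∅ countable_empty ?_ ?_ ?_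
  rotate_left
  · intro i p hp
    obtain ⟨F', hF', -⟩ := exists_hasFDerivAt_flux hΦ (hUd p (hbox hp)) (hL p (hbox hp))
    exact (hF' i).continuousAt.continuousWithinAt
  · intro p hp i
    have hp' : p ∈ box T r := ⟨fun i => (hp.1 i trivial).1.le, fun i => (hp.1 i trivial).2.le⟩
    obtain ⟨F', hF', -⟩ := exists_hasFDerivAt_flux hΦ (hUd p (hbox hp')) (hL p (hbox hp'))
    exact (hF' i).differentiableAt.hasFDerivAt
  all_goals
    have hzero : ∀ p ∈ box T r, ∑ i, fderiv ℝ (flux a U Φ i) p (Pi.single i 1) = 0 := by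
      intro p hp
      obtain ⟨F', hF', h0⟩ := exists_hasFDerivAt_flux hΦ (hUd p (hbox hp)) (hL p (hbox hp))
      rw [← h0]
      exact Finset.sum_congr rfl fun i _ => by rw [(hF' i).fderiv]
  · exact (integrableOn_zero (μ := volume)).congr_fun (fun p hp => (hzero p hp).symm)
      measurableSet_Icc
  rw [setIntegral_congr_fun measurableSet_Icc (g := fun _ => (0 : ℂ)) (fun p hp => hzero p hp),
    integral_zero, Fin.sum_univ_three] at hdiv
  have hface : ∀ (i : Fin 3) (t : ℝ), t ∈ Icc (lo i) (hi i) →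
      (∀ x : Fin 2 → ℝ, i.insertNth (α := fun _ => ℝ) t x 0 = T ∨
        |i.insertNth (α := fun _ => ℝ) t x 1| = r ∨
        |i.insertNth (α := fun _ => ℝ) t x 2| = r) →
      ‖∫ x in Icc (lo ∘ i.succAbove) (hi ∘ i.succAbove), flux a U Φ i (i.insertNth t x)‖
        ≤ c * M * N * v i := by
    intro i t ht hx
    refine norm_setIntegral_le_of_norm_le_const isCompact_Icc.measure_lt_top fun x hx' => ?_
    exact hflux _ (Fin.insertNth_mem_Icc.2 ⟨ht, hx'⟩) (hx x) i
  have hb0 : (∫ q in Icc (fun _ : Fin 2 => -r) (fun _ => r),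
      ∑ i, U ![0, q 0, q 1] i * Φ i ![0, q 0, q 1]) =
      ∫ x in Icc (lo ∘ (0 : Fin 3).succAbove) (hi ∘ (0 : Fin 3).succAbove),
        flux a U Φ 0 ((0 : Fin 3).insertNth (lo 0) x) := by
    have e1 : (fun _ : Fin 2 => -r) = lo ∘ (0 : Fin 3).succAbove := by
      funext i; fin_cases i <;> rfl
    have e2 : (fun _ : Fin 2 => r) = hi ∘ (0 : Fin 3).succAbove := by
      funext i; fin_cases i <;> rfl
    rw [e1, e2]
    refine integral_congr_ae (Eventually.of_forall fun q => ?_)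
    have e3 : (0 : Fin 3).insertNth (lo 0) q = ![0, q 0, q 1] := by
      funext i; fin_cases i <;> rfl
    simp only [e3, Fin.sum_univ_three]
    rfl
  rw [hb0]
  have f0 := hface 0 (hi 0) ⟨hle 0, le_rfl⟩ fun x => Or.inl rfl
  have f1 := hface 1 (hi 1) ⟨hle 1, le_rfl⟩ fun x => Or.inr (Or.inl (abs_of_nonneg hr))
  have f1' := hface 1 (lo 1) ⟨le_rfl, hle 1⟩ fun x =>
    Or.inr (Or.inl (by change |-r| = r; rw [abs_neg, abs_of_nonneg hr]))
  have f2 := hface 2 (hi 2) ⟨hle 2, le_rfl⟩ fun x => Or.inr (Or.inr (abs_of_nonneg hr))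
  have f2' := hface 2 (lo 2) ⟨le_rfl, hle 2⟩ fun x =>
    Or.inr (Or.inr (by change |-r| = r; rw [abs_neg, abs_of_nonneg hr]))
  generalize (∫ x in Icc (lo ∘ (0 : Fin 3).succAbove) (hi ∘ (0 : Fin 3).succAbove),
        flux a U Φ 0 ((0 : Fin 3).insertNth (lo 0) x)) = I0 at *
  generalize (∫ x in Icc (lo ∘ (0 : Fin 3).succAbove) (hi ∘ (0 : Fin 3).succAbove),
        flux a U Φ 0 ((0 : Fin 3).insertNth (hi 0) x)) = J0 at *
  generalize (∫ x in Icc (lo ∘ (1 : Fin 3).succAbove) (hi ∘ (1 : Fin 3).succAbove),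
        flux a U Φ 1 ((1 : Fin 3).insertNth (lo 1) x)) = I1 at *
  generalize (∫ x in Icc (lo ∘ (1 : Fin 3).succAbove) (hi ∘ (1 : Fin 3).succAbove),
        flux a U Φ 1 ((1 : Fin 3).insertNth (hi 1) x)) = J1 at *
  generalize (∫ x in Icc (lo ∘ (2 : Fin 3).succAbove) (hi ∘ (2 : Fin 3).succAbove),
        flux a U Φ 2 ((2 : Fin 3).insertNth (lo 2) x)) = I2 at *
  generalize (∫ x in Icc (lo ∘ (2 : Fin 3).succAbove) (hi ∘ (2 : Fin 3).succAbove),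
        flux a U Φ 2 ((2 : Fin 3).insertNth (hi 2) x)) = J2 at *
  have hI : I0 = J0 + (J1 - I1) + (J2 - I2) := by linear_combination hdiv
  rw [hI]
  refine norm_add₃_le.trans ?_
  linarith [norm_sub_le J1 I1, norm_sub_le J2 I2]

/-! ### Explicit solutions of the adjoint system -/

/-- `A^{-1/2} e^{B²/(4A)}`, which up to the factor `√π` is `∫ e^{-Aσ² + Bσ} dσ`. It satisfies the
heat equation `∂_B² = -∂_A`. -/
def heatKernel (A B : ℂ) : ℂ := Complex.exp (B ^ 2 * A⁻¹ / 4 - Complex.log A / 2)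

/-- The derivative `∂_B` of `heatKernel`. -/
def heatKernelD (A B : ℂ) : ℂ := B * A⁻¹ / 2 * heatKernel A B

/-- The second derivative `∂_B² = -∂_A` of `heatKernel`. -/
def heatKernelDD (A B : ℂ) : ℂ := (B ^ 2 * A⁻¹ ^ 2 / 4 + A⁻¹ / 2) * heatKernel A B

/-- The third derivative `∂_B³ = -∂_A ∂_B` of `heatKernel`. -/
def heatKernelDDD (A B : ℂ) : ℂ :=
  (3 * B * A⁻¹ ^ 2 / 4 + B ^ 3 * A⁻¹ ^ 3 / 8) * heatKernel A B

section derivatives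

variable {E : Type*} [NormedAddCommGroup E] [NormedSpace ℝ E] {A B : E → ℂ} {A' B' : E →L[ℝ] ℂ}
  {p : E}

theorem hasFDerivAt_heatKernel (hA : HasFDerivAt A A' p) (hB : HasFDerivAt B B' p)
    (h : 0 < (A p).re) :
    HasFDerivAt (fun p => heatKernel (A p) (B p))
      (heatKernelD (A p) (B p) • B' - heatKernelDD (A p) (B p) • A') p := by
  have hs : A p ∈ Complex.slitPlane := Or.inl h
  have hinv : HasFDerivAt (fun p => (A p)⁻¹) (-(((A p) ^ 2)⁻¹) • A') p :=
    (hasDerivAt_inv (Complex.slitPlane_ne_zero hs)).comp_hasFDerivAt p hA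
  have hlog : HasFDerivAt (fun p => Complex.log (A p)) ((A p)⁻¹ • A') p :=
    (Complex.hasDerivAt_log hs).comp_hasFDerivAt p hA
  have hψ := ((((hB.pow 2).mul hinv).const_mul (1 / 4)).sub (hlog.const_mul (1 / 2))).cexp
  have hfun : (fun p => heatKernel (A p) (B p)) = fun p => Complex.exp
      (1 / 4 * (B p ^ 2 * (A p)⁻¹) - 1 / 2 * Complex.log (A p)) := by
    funext p
    rw [heatKernel]
    congr 1
    ring
  rw [hfun]
  refine hψ.congr_fderiv ?_
  ext v
  simp [heatKernelD, heatKernelDD, heatKernel]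
  ring_nf

theorem hasFDerivAt_heatKernelD (hA : HasFDerivAt A A' p) (hB : HasFDerivAt B B' p)
    (h : 0 < (A p).re) :
    HasFDerivAt (fun p => heatKernelD (A p) (B p))
      (heatKernelDD (A p) (B p) • B' - heatKernelDDD (A p) (B p) • A') p := by
  have hs : A p ∈ Complex.slitPlane := Or.inl h
  have hinv : HasFDerivAt (fun p => (A p)⁻¹) (-(((A p) ^ 2)⁻¹) • A') p :=
    (hasDerivAt_inv (Complex.slitPlane_ne_zero hs)).comp_hasFDerivAt p hA
  have hψ := ((hB.mul hinv).const_mul (1 / 2)).mul (hasFDerivAt_heatKernel hA hB h)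
  have hfun : (fun p => heatKernelD (A p) (B p)) = fun p =>
      (1 / 2 * (B p * (A p)⁻¹)) * heatKernel (A p) (B p) := by
    funext p
    rw [heatKernelD]
    ring
  rw [hfun]
  refine hψ.congr_fderiv ?_
  ext v
  simp [heatKernelD, heatKernelDD, heatKernelDDD]
  ring_nf

theorem hasFDerivAt_heatKernelDD (hA : HasFDerivAt A A' p) (hB : HasFDerivAt B B' p)
    (h : 0 < (A p).re) : ∃ S : ℂ,
    HasFDerivAt (fun p => heatKernelDD (A p) (B p))
      (heatKernelDDD (A p) (B p) • B' - S • A') p := by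
  have hs : A p ∈ Complex.slitPlane := Or.inl h
  have hinv : HasFDerivAt (fun p => (A p)⁻¹) (-(((A p) ^ 2)⁻¹) • A') p :=
    (hasDerivAt_inv (Complex.slitPlane_ne_zero hs)).comp_hasFDerivAt p hA
  have hψ := ((((hB.pow 2).mul (hinv.pow 2)).const_mul (1 / 4)).add
    (hinv.const_mul (1 / 2))).mul (hasFDerivAt_heatKernel hA hB h)
  have hfun : (fun p => heatKernelDD (A p) (B p)) = fun p =>
      (1 / 4 * (B p ^ 2 * (A p)⁻¹ ^ 2) + 1 / 2 * (A p)⁻¹) * heatKernel (A p) (B p) := by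
    funext p
    rw [heatKernelDD]
    ring
  refine ⟨(B p ^ 2 * (A p)⁻¹ ^ 3 / 2 + (A p)⁻¹ ^ 2 / 2) * heatKernel (A p) (B p) +
    (B p ^ 2 * (A p)⁻¹ ^ 2 / 4 + (A p)⁻¹ / 2) * heatKernelDD (A p) (B p), ?_⟩
  rw [hfun]
  refine hψ.congr_fderiv ?_
  ext v
  simp [heatKernelD, heatKernelDD, heatKernelDDD]
  ring_nf

end derivatives

/-- The complex phase `δ + x²/2 + iεy`. -/
def phase (ε δ : ℝ) (x y : ℝ) : ℂ := δ + x ^ 2 / 2 + Complex.I * ε * y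

@[simp] theorem phase_re (ε δ x y : ℝ) : (phase ε δ x y).re = δ + x ^ 2 / 2 := by
  have : phase ε δ x y = ((δ + x ^ 2 / 2 : ℝ) : ℂ) + ((ε * y : ℝ) : ℂ) * Complex.I := by
    rw [phase]; push_cast; ring
  rw [this, Complex.add_re, Complex.ofReal_re, Complex.re_ofReal_mul, Complex.I_re]
  ring

@[simp] theorem phase_im (ε δ x y : ℝ) : (phase ε δ x y).im = ε * y := by
  have : phase ε δ x y = ((δ + x ^ 2 / 2 : ℝ) : ℂ) + ((ε * y : ℝ) : ℂ) * Complex.I := by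
    rw [phase]; push_cast; ring
  rw [this, Complex.add_im, Complex.ofReal_im, Complex.im_ofReal_mul, Complex.I_im]
  ring

theorem phase_re_pos {ε δ : ℝ} (hδ : 0 < δ) (x y : ℝ) : 0 < (phase ε δ x y).re := by
  rw [phase_re]; positivity

/-- The solution of the adjoint system generated by the potential
`heatKernel (phase x y) (b + κ (T - t))`. -/
def testSolution (a κ b : ℂ) (ε δ T : ℝ) : Fin 3 → (Fin 3 → ℝ) → ℂ :=
  ![fun p => -κ * heatKernelD (phase ε δ (p 1) (p 2)) (b + κ * (T - p 0)),
    fun p => p 1 * ((1 + Complex.I * ε * a) *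
      heatKernelDD (phase ε δ (p 1) (p 2)) (b + κ * (T - p 0))),
    fun p => p 1 * ((Complex.I * ε) *
      heatKernelDD (phase ε δ (p 1) (p 2)) (b + κ * (T - p 0)))]

theorem isAdjointSolution_testSolution {a κ : ℂ} {ε δ : ℝ} (b : ℂ) (T : ℝ) (hδ : 0 < δ)
    (hε : ε ^ 2 = 1) (hκ : κ ^ 2 = -(1 + Complex.I * ε * a)) :
    IsAdjointSolution a (testSolution a κ b ε δ T) := by
  intro p
  have hpr : ∀ i, HasFDerivAt (fun p : Fin 3 → ℝ => ((p i : ℝ) : ℂ))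
      (Complex.ofRealCLM.comp (ContinuousLinearMap.proj i : (Fin 3 → ℝ) →L[ℝ] ℝ)) p := fun i =>
    (Complex.ofRealCLM.comp (ContinuousLinearMap.proj i : (Fin 3 → ℝ) →L[ℝ] ℝ)).hasFDerivAt
  have hA : HasFDerivAt (fun p : Fin 3 → ℝ => phase ε δ (p 1) (p 2))
      ((p 1 : ℂ) • Complex.ofRealCLM.comp (ContinuousLinearMap.proj 1 : (Fin 3 → ℝ) →L[ℝ] ℝ) +
        (Complex.I * ε) •
          Complex.ofRealCLM.comp (ContinuousLinearMap.proj 2 : (Fin 3 → ℝ) →L[ℝ] ℝ)) p := by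
    have h := ((((hpr 1).pow 2).const_mul (1 / 2)).const_add (δ : ℂ)).add
      ((hpr 2).const_mul (Complex.I * ε))
    have hfun : (fun p : Fin 3 → ℝ => phase ε δ (p 1) (p 2)) = fun p : Fin 3 → ℝ =>
        ((δ : ℂ) + 1 / 2 * (p 1 : ℂ) ^ 2) + Complex.I * ε * (p 2 : ℂ) := by
      funext p
      rw [phase]
      ring
    rw [hfun]
    refine h.congr_fderiv ?_
    ext v
    simp
    ring
  have hB : HasFDerivAt (fun p : Fin 3 → ℝ => b + κ * (T - p 0))
      (-κ • Complex.ofRealCLM.comp (ContinuousLinearMap.proj 0 : (Fin 3 → ℝ) →L[ℝ] ℝ)) p := by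
    refine ((((hpr 0).const_sub (T : ℂ)).const_mul κ).const_add b).congr_fderiv ?_
    ext v
    simp
  have hre := phase_re_pos (ε := ε) hδ (p 1) (p 2)
  have hP := hasFDerivAt_heatKernelD hA hB hre
  obtain ⟨S, hQ⟩ := hasFDerivAt_heatKernelDD hA hB hre
  have h0 : HasFDerivAt (testSolution a κ b ε δ T 0) _ p := hP.const_mul (-κ)
  have h1 : HasFDerivAt (testSolution a κ b ε δ T 1) _ p :=
    (hpr 1).mul (hQ.const_mul (1 + Complex.I * ε * a))
  have h2 : HasFDerivAt (testSolution a κ b ε δ T 2) _ p :=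
    (hpr 1).mul (hQ.const_mul (Complex.I * ε))
  have hε' : (ε : ℂ) ^ 2 = 1 := by exact_mod_cast hε
  refine ⟨fun i => fderiv ℝ (testSolution a κ b ε δ T i) p, fun i => ?_, ?_⟩
  · fin_cases i
    · exact h0.differentiableAt.hasFDerivAt
    · exact h1.differentiableAt.hasFDerivAt
    · exact h2.differentiableAt.hasFDerivAt
  · beta_reduce
    rw [h0.fderiv, h1.fderiv, h2.fderiv]
    refine ⟨?_, ?_, ?_⟩
    · simp
      linear_combination (heatKernelDD (phase ε δ (p 1) (p 2)) (b + κ * (T - p 0))) * hκ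
        + ((p 1 : ℂ) ^ 2 * S * (a ^ 2 * ε ^ 2 - (1 + a ^ 2) * ε ^ 2)) * Complex.I_sq
        + ((p 1 : ℂ) ^ 2 * S) * hε'
    · simp
      ring
    · simp
      ring

/-! ### Size of the explicit solutions -/

/-- With `B = u + iw` and `A = p + iq` the difference of the two sides is
`(u q - w p)² / (4 p |A|²)` when `δ = p`, and the bound is monotone in `δ`. -/
theorem re_sq_mul_inv_le {A B : ℂ} {δ : ℝ} (hδ : 0 < δ) (hA : δ ≤ A.re) :
    (B ^ 2 * A⁻¹ / 4).re ≤ B.re ^ 2 / (4 * δ) := by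
  have hp : 0 < A.re := hδ.trans_le hA
  have hn : 0 < A.re * A.re + A.im * A.im :=
    add_pos_of_pos_of_nonneg (mul_pos hp hp) (mul_self_nonneg _)
  have h1 : (B ^ 2 * A⁻¹ / 4).re =
      ((B.re ^ 2 - B.im ^ 2) * A.re + 2 * B.re * B.im * A.im) /
        (A.re * A.re + A.im * A.im) / 4 := by
    have : (4 : ℂ) = ((4 : ℝ) : ℂ) := by norm_num
    rw [this, Complex.div_ofReal_re, Complex.mul_re, Complex.inv_re, Complex.inv_im,
      Complex.normSq_apply, pow_two, Complex.mul_re, Complex.mul_im]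
    ring
  rw [h1]
  have h2 : ((B.re ^ 2 - B.im ^ 2) * A.re + 2 * B.re * B.im * A.im) /
      (A.re * A.re + A.im * A.im) ≤ B.re ^ 2 / A.re := by
    rw [div_le_div_iff₀ hn hp]
    nlinarith [sq_nonneg (B.re * A.im - B.im * A.re)]
  have h3 : B.re ^ 2 / A.re ≤ B.re ^ 2 / δ := by gcongr
  have h4 : B.re ^ 2 / (4 * δ) = B.re ^ 2 / δ / 4 := by field_simp
  rw [h4]
  linarith

/-- Away from the centre of the wave packet the exponent is at most half of its maximum, up to a
term linear in `Re B`. -/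
theorem re_sq_mul_inv_le_of_far {A B : ℂ} {δ : ℝ} (hδ : 0 < δ) (hA : δ ≤ A.re)
    (hfar : 2 * δ ≤ A.re ∨ δ ≤ |A.im|) :
    (B ^ 2 * A⁻¹ / 4).re ≤ B.re ^ 2 / (8 * δ) + |B.re| * |B.im| / (4 * δ) := by
  have hp : 0 < A.re := hδ.trans_le hA
  have hn : 0 < A.re * A.re + A.im * A.im :=
    add_pos_of_pos_of_nonneg (mul_pos hp hp) (mul_self_nonneg _)
  have h1 : (B ^ 2 * A⁻¹ / 4).re =
      (B.re ^ 2 * (A.re / (A.re * A.re + A.im * A.im)) -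
        B.im ^ 2 * (A.re / (A.re * A.re + A.im * A.im)) +
        2 * B.re * B.im * A.im / (A.re * A.re + A.im * A.im)) / 4 := by
    have : (4 : ℂ) = ((4 : ℝ) : ℂ) := by norm_num
    rw [this, Complex.div_ofReal_re, Complex.mul_re, Complex.inv_re, Complex.inv_im,
      Complex.normSq_apply, pow_two, Complex.mul_re, Complex.mul_im]
    ring
  have h2 : A.re / (A.re * A.re + A.im * A.im) ≤ 1 / (2 * δ) := by
    rw [div_le_div_iff₀ hn (by positivity)]
    rcases hfar with h | h
    · nlinarith [mul_self_nonneg A.im]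
    · have h3 : |A.im| * |A.im| = A.im * A.im := abs_mul_abs_self _
      nlinarith [sq_nonneg (A.re - |A.im|)]
  have h3 : 2 * B.re * B.im * A.im / (A.re * A.re + A.im * A.im) ≤ |B.re| * |B.im| / δ := by
    rw [div_le_div_iff₀ hn hδ]
    have e1 : B.re * B.im * A.im ≤ |B.re| * |B.im| * |A.im| := by
      rw [← abs_mul, ← abs_mul]; exact le_abs_self _
    have e2 : 2 * |A.im| * δ ≤ A.re * A.re + A.im * A.im := by
      have h3 : |A.im| * |A.im| = A.im * A.im := abs_mul_abs_self _
      nlinarith [sq_nonneg (A.re - |A.im|), abs_nonneg A.im]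
    calc 2 * B.re * B.im * A.im * δ ≤ 2 * (|B.re| * |B.im| * |A.im|) * δ := by nlinarith
      _ = |B.re| * |B.im| * (2 * |A.im| * δ) := by ring
      _ ≤ _ := by gcongr
  have h4 : 0 ≤ B.im ^ 2 * (A.re / (A.re * A.re + A.im * A.im)) := by positivity
  have h5 := mul_le_mul_of_nonneg_left h2 (sq_nonneg B.re)
  have h6 : B.re ^ 2 / (8 * δ) + |B.re| * |B.im| / (4 * δ) =
      (B.re ^ 2 * (1 / (2 * δ)) + |B.re| * |B.im| / δ) / 4 := by field_simp; ring
  rw [h1, h6]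
  linarith

theorem norm_heatKernel_le {A B : ℂ} {δ e : ℝ} (hδ : 0 < δ) (hA : δ ≤ A.re)
    (he : (B ^ 2 * A⁻¹ / 4).re ≤ e) :
    ‖heatKernel A B‖ ≤ Real.exp (-(Real.log δ / 2)) * Real.exp e := by
  rw [heatKernel, Complex.norm_exp, ← Real.exp_add, Complex.sub_re]
  refine Real.exp_le_exp.2 ?_
  have h1 : (Complex.log A / 2).re = Real.log ‖A‖ / 2 := by
    have : (2 : ℂ) = ((2 : ℝ) : ℂ) := by norm_num
    rw [this, Complex.div_ofReal_re, Complex.log_re]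
  have h2 : Real.log δ ≤ Real.log ‖A‖ := Real.log_le_log hδ (hA.trans (Complex.re_le_norm A))
  rw [h1]
  linarith

theorem norm_inv_le_of_le_re {A : ℂ} {δ : ℝ} (hδ : 0 < δ) (hA : δ ≤ A.re) : ‖A⁻¹‖ ≤ δ⁻¹ := by
  rw [norm_inv]
  exact inv_anti₀ hδ (hA.trans (Complex.re_le_norm A))

theorem norm_heatKernelD_le {A B : ℂ} {δ e : ℝ} (hδ : 0 < δ) (hA : δ ≤ A.re)
    (he : (B ^ 2 * A⁻¹ / 4).re ≤ e) :
    ‖heatKernelD A B‖ ≤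
      (‖B‖ * δ⁻¹ / 2) * (Real.exp (-(Real.log δ / 2)) * Real.exp e) := by
  rw [heatKernelD, norm_mul, norm_div, norm_mul, Complex.norm_ofNat]
  have h1 := norm_inv_le_of_le_re hδ hA
  have h2 := norm_heatKernel_le hδ hA he
  gcongr

theorem norm_heatKernelDD_le {A B : ℂ} {δ e : ℝ} (hδ : 0 < δ) (hA : δ ≤ A.re)
    (he : (B ^ 2 * A⁻¹ / 4).re ≤ e) :
    ‖heatKernelDD A B‖ ≤
      (‖B‖ ^ 2 * δ⁻¹ ^ 2 / 4 + δ⁻¹ / 2) * (Real.exp (-(Real.log δ / 2)) * Real.exp e) := by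
  rw [heatKernelDD, norm_mul]
  have h1 := norm_inv_le_of_le_re hδ hA
  have h2 := norm_heatKernel_le hδ hA he
  have h3 : ‖B ^ 2 * A⁻¹ ^ 2 / 4 + A⁻¹ / 2‖ ≤ ‖B‖ ^ 2 * δ⁻¹ ^ 2 / 4 + δ⁻¹ / 2 := by
    refine (norm_add_le _ _).trans ?_
    rw [norm_div, norm_mul, norm_pow, norm_pow, norm_div, Complex.norm_ofNat, Complex.norm_ofNat]
    gcongr
  exact mul_le_mul h3 h2 (norm_nonneg _) (by positivity)

/-- Uniform bounds for the adjoint wave packets on the final time slice and away from the centre.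
The imaginary shift `-i (Im κ) T` makes the parameter at time `0` real and costs nothing at
time `T`, by `re_sq_mul_inv_le`. -/
theorem exists_norm_heatKernel_le {κ : ℂ} (hκ : 0 < κ.re) {ε δ T : ℝ} (hδ : 0 < δ) (hT : 0 ≤ T) :
    ∃ C : ℝ, 0 ≤ C ∧ ∀ β t x y : ℝ, 0 ≤ β → 0 ≤ t → t ≤ T →
      (t = T ∨ 2 * δ ≤ δ + x ^ 2 / 2 ∨ δ ≤ |ε * y|) →
      ‖heatKernelD (phase ε δ x y) (β - Complex.I * κ.im * T + κ * (T - t))‖ ≤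
        C * ((1 + β) ^ 2 * Real.exp (β ^ 2 / (4 * δ))) ∧
      ‖heatKernelDD (phase ε δ x y) (β - Complex.I * κ.im * T + κ * (T - t))‖ ≤
        C * ((1 + β) ^ 2 * Real.exp (β ^ 2 / (4 * δ))) := by
  set L : ℝ := κ.re * T with hL
  set N : ℝ := |κ.im| * T with hN
  have hL0 : 0 ≤ L := by positivity
  have hN0 : 0 ≤ N := by positivity
  set M : ℝ := ((L + N) ^ 2 / 2 + L ^ 2 / 2 + L * N) / (4 * δ) with hM
  have hM0 : 0 ≤ M := by positivity
  set E : ℝ := Real.exp (-(Real.log δ / 2)) * Real.exp M with hE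
  set c : ℝ := 1 + L + N with hc
  have hc0 : 0 ≤ c := by positivity
  refine ⟨(c * δ⁻¹ / 2 + (c ^ 2 * δ⁻¹ ^ 2 / 4 + δ⁻¹ / 2)) * E, by positivity,
    fun β t x y hβ ht0 htT hcase => ?_⟩
  set A := phase ε δ x y with hA
  set B : ℂ := β - Complex.I * κ.im * T + κ * (T - t) with hB
  have hBre : B.re = β + κ.re * (T - t) := by simp [hB]
  have hBim : B.im = -(κ.im * t) := by simp [hB]; ring
  have hre0 : 0 ≤ κ.re * (T - t) := mul_nonneg hκ.le (by linarith)
  have hreL : κ.re * (T - t) ≤ L := mul_le_mul_of_nonneg_left (by linarith) hκ.le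
  have himN : |B.im| ≤ N := by
    rw [hBim, abs_neg, abs_mul, abs_of_nonneg ht0]
    exact mul_le_mul_of_nonneg_left htT (abs_nonneg _)
  have hreabs : |B.re| = B.re := abs_of_nonneg (by rw [hBre]; linarith)
  have hBn : ‖B‖ ≤ c * (1 + β) := by
    refine (Complex.norm_le_abs_re_add_abs_im B).trans ?_
    rw [hreabs, hBre, hc]
    nlinarith [mul_nonneg hL0 hβ, mul_nonneg hN0 hβ]
  have hAre : δ ≤ A.re := by rw [hA, phase_re]; nlinarith [sq_nonneg x]
  have he : (B ^ 2 * A⁻¹ / 4).re ≤ β ^ 2 / (4 * δ) + M := by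
    have hfar : ∀ h : 2 * δ ≤ A.re ∨ δ ≤ |A.im|,
        (B ^ 2 * A⁻¹ / 4).re ≤ β ^ 2 / (4 * δ) + M := by
      intro h
      refine (re_sq_mul_inv_le_of_far hδ hAre h).trans ?_
      have h1 : B.re ^ 2 / (8 * δ) + |B.re| * |B.im| / (4 * δ) =
          (B.re ^ 2 / 2 + |B.re| * |B.im|) / (4 * δ) := by field_simp; ring
      rw [h1, hM, ← add_div]
      refine div_le_div_of_nonneg_right ?_ (by positivity)
      have h2 : B.re ≤ β + L := by rw [hBre]; linarith
      have h3 : 0 ≤ B.re := by rw [hBre]; linarith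
      have h4 : |B.re| * |B.im| ≤ (β + L) * N := by
        rw [hreabs]; exact mul_le_mul h2 himN (abs_nonneg _) (by positivity)
      have h5 : B.re ^ 2 ≤ (β + L) ^ 2 := by gcongr
      nlinarith [sq_nonneg (β - (L + N))]
    rcases hcase with h | h | h
    · have h1 := re_sq_mul_inv_le (B := B) hδ hAre
      have h2 : B.re = β := by rw [hBre, h]; ring
      rw [h2] at h1
      linarith
    · exact hfar (Or.inl (by rw [hA, phase_re]; exact h))
    · exact hfar (Or.inr (by rw [hA, phase_im]; exact h))
  have hb1 : (1 : ℝ) ≤ 1 + β := by linarith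
  have hb2 : 1 + β ≤ (1 + β) ^ 2 := by nlinarith
  have hexp : Real.exp (-(Real.log δ / 2)) * Real.exp (β ^ 2 / (4 * δ) + M) =
      E * Real.exp (β ^ 2 / (4 * δ)) := by rw [Real.exp_add, hE]; ring
  have hE0 : 0 ≤ E := by positivity
  constructor
  · refine (norm_heatKernelD_le hδ hAre he).trans ?_
    rw [hexp]
    calc ‖B‖ * δ⁻¹ / 2 * (E * Real.exp (β ^ 2 / (4 * δ)))
        ≤ (c * (1 + β) ^ 2) * δ⁻¹ / 2 * (E * Real.exp (β ^ 2 / (4 * δ))) := by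
          gcongr
          exact hBn.trans (by gcongr)
      _ = (c * δ⁻¹ / 2) * E * ((1 + β) ^ 2 * Real.exp (β ^ 2 / (4 * δ))) := by ring
      _ ≤ _ := by
          gcongr
          have : 0 ≤ c ^ 2 * δ⁻¹ ^ 2 / 4 + δ⁻¹ / 2 := by positivity
          linarith
  · refine (norm_heatKernelDD_le hδ hAre he).trans ?_
    rw [hexp]
    calc (‖B‖ ^ 2 * δ⁻¹ ^ 2 / 4 + δ⁻¹ / 2) * (E * Real.exp (β ^ 2 / (4 * δ)))
        ≤ ((c * (1 + β)) ^ 2 * δ⁻¹ ^ 2 / 4 + (1 + β) ^ 2 * (δ⁻¹ / 2)) *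
            (E * Real.exp (β ^ 2 / (4 * δ))) := by
          gcongr
          exact le_mul_of_one_le_left (by positivity) (by linarith)
      _ = (c ^ 2 * δ⁻¹ ^ 2 / 4 + δ⁻¹ / 2) * E *
            ((1 + β) ^ 2 * Real.exp (β ^ 2 / (4 * δ))) := by ring
      _ ≤ _ := by
          have : 0 ≤ c * δ⁻¹ / 2 := by positivity
          exact mul_le_mul_of_nonneg_right (mul_le_mul_of_nonneg_right (by linarith) hE0)
            (by positivity)

/-! ### The upper bound for the pairing -/

theorem norm_gevreySeries_term (ε s : ℝ) (j : ℕ) (y : ℝ) :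
    ‖(Real.exp (-2 * j) : ℂ) * Complex.exp (Complex.I * ((ε * (j : ℝ) ^ s : ℝ) : ℂ) * y)‖ =
      Real.exp (-2 * j) := by
  have : Complex.I * ((ε * (j : ℝ) ^ s : ℝ) : ℂ) * y =
      ((ε * (j : ℝ) ^ s * y : ℝ) : ℂ) * Complex.I := by push_cast; ring
  rw [norm_mul, this, Complex.norm_exp_ofReal_mul_I, mul_one, Complex.norm_real,
    Real.norm_eq_abs, Real.abs_exp]

theorem summable_exp_neg_two_mul_nat : Summable fun j : ℕ => Real.exp (-2 * (j : ℝ)) :=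
  summable_exp_neg_nat.of_nonneg_of_le (fun _ => by positivity) fun j =>
    Real.exp_le_exp.2 (by nlinarith [(Nat.cast_nonneg j : (0 : ℝ) ≤ j)])

theorem continuous_profile {ε s : ℝ} (hε : |ε| = 1) (hs : 1 ≤ s) : Continuous (profile ε s) :=
  (uniformGevrey_profile hε hs).1.continuous

theorem norm_cexp_neg_sq (y : ℝ) : ‖Complex.exp (-(y : ℂ) ^ 2)‖ = Real.exp (-1 * y ^ 2) := by
  rw [Complex.norm_exp]
  congr 1
  simp [← Complex.ofReal_pow]

theorem integrable_profile {ε s : ℝ} (hε : |ε| = 1) (hs : 1 ≤ s) : Integrable (profile ε s) := by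
  refine ((integrable_exp_neg_mul_sq one_pos).mul_const
    (∑' j : ℕ, Real.exp (-2 * (j : ℝ)))).mono' (continuous_profile hε hs).aestronglyMeasurable
    (Eventually.of_forall fun y => ?_)
  rw [profile, norm_mul, norm_cexp_neg_sq]
  gcongr
  exact tsum_of_norm_bounded summable_exp_neg_two_mul_nat.hasSum
    fun j => (norm_gevreySeries_term ε s j y).le

theorem continuous_phase (ε δ : ℝ) : Continuous fun z : ℝ × ℝ => phase ε δ z.1 z.2 := by
  unfold phase
  fun_prop

theorem continuous_heatKernelD_phase (ε : ℝ) {δ : ℝ} (hδ : 0 < δ) (B : ℂ) :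
    Continuous fun z : ℝ × ℝ => heatKernelD (phase ε δ z.1 z.2) B := by
  have h1 := continuous_phase ε δ
  have h2 : ∀ z : ℝ × ℝ, phase ε δ z.1 z.2 ∈ Complex.slitPlane := fun z =>
    Or.inl (phase_re_pos hδ _ _)
  have h3 : Continuous fun z : ℝ × ℝ => (phase ε δ z.1 z.2)⁻¹ :=
    h1.inv₀ fun z => Complex.slitPlane_ne_zero (h2 z)
  have h4 : Continuous fun z : ℝ × ℝ => Complex.log (phase ε δ z.1 z.2) := h1.clog h2
  unfold heatKernelD heatKernel
  fun_prop

theorem integrable_profile_mul_heatKernelD {ε s δ : ℝ} (hε : |ε| = 1) (hs : 1 ≤ s) (hδ : 0 < δ)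
    (B : ℂ) (r : ℝ) :
    Integrable (fun z : ℝ × ℝ => profile ε s z.2 * heatKernelD (phase ε δ z.1 z.2) B)
      ((volume.restrict (Icc (-r) r)).prod volume) := by
  have hc : Continuous (fun z : ℝ × ℝ => profile ε s z.2 * heatKernelD (phase ε δ z.1 z.2) B) :=
    ((continuous_profile hε hs).comp continuous_snd).mul (continuous_heatKernelD_phase ε hδ B)
  have hdom : Integrable (fun z : ℝ × ℝ => (((‖B‖ * δ⁻¹ / 2) * (Real.exp (-(Real.log δ / 2)) *
      Real.exp (B.re ^ 2 / (4 * δ))) : ℝ)) * ‖profile ε s z.2‖)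
      ((volume.restrict (Icc (-r) r)).prod volume) :=
    (integrable_const _).mul_prod (integrable_profile hε hs).norm
  refine hdom.mono' hc.aestronglyMeasurable (Eventually.of_forall fun z => ?_)
  have hA : δ ≤ (phase ε δ z.1 z.2).re := by rw [phase_re]; nlinarith [sq_nonneg z.1]
  rw [norm_mul, mul_comm]
  gcongr
  exact norm_heatKernelD_le hδ hA (re_sq_mul_inv_le hδ hA)

/-- A solution of the Cauchy problem whose data are given by the profile near the origin bounds
the pairing of the profile with the wave packets by their size on the rest of the boundary. -/
theorem exists_norm_integral_profile_le {a κ : ℂ} {ε s : ℝ} (hε : |ε| = 1) (hs : 1 ≤ s)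
    (hκ0 : 0 < κ.re) (hκ : κ ^ 2 = -(1 + Complex.I * ε * a))
    {U₀ : (Fin 2 → ℝ) → (Fin 3 → ℂ)}
    (hU₀ : ∀ x y : ℝ, |x| ≤ 1 → |y| ≤ 1 → U₀ ![x, y] = ![profile ε s y, 0, 0])
    {Ω : Set (Fin 3 → ℝ)} (hΩ : IsOpen Ω) (h0 : (0 : Fin 3 → ℝ) ∈ Ω)
    {U : (Fin 3 → ℝ) → (Fin 3 → ℂ)} (hU : IsCauchySolution a U₀ Ω U) :
    ∃ T r δ C : ℝ, 0 < T ∧ 0 < r ∧ 0 < δ ∧ ∀ β : ℝ, 0 ≤ β →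
      ‖∫ x in Icc (-r) r, ∫ y, profile ε s y *
        heatKernelD (phase ε δ x y) ((β + κ.re * T : ℝ) : ℂ)‖ ≤
      C * ((1 + β) ^ 2 * Real.exp (β ^ 2 / (4 * δ))) := by
  obtain ⟨ρ, hρ, hρΩ⟩ := Metric.isOpen_iff.1 hΩ 0 h0
  set r : ℝ := min (ρ / 2) 1 with hr
  have hr0 : 0 < r := by positivity
  have hr1 : r ≤ 1 := min_le_right _ _
  -- With this `δ` the sides `|x| = r` and `|y| = r` are far from the centre of the packets:
  -- `2δ ≤ δ + r²/2` and `δ ≤ r`.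
  set δ : ℝ := r ^ 2 / 2 with hδ
  have hδ0 : 0 < δ := by positivity
  have hδr : δ ≤ r := by rw [hδ]; nlinarith
  have hbox : box r r ⊆ Ω := by
    refine fun p hp => hρΩ ?_
    obtain ⟨⟨h1, h2⟩, h3, h4⟩ := mem_box.1 hp
    rw [mem_ball_zero_iff]
    refine lt_of_le_of_lt ((pi_norm_le_iff_of_nonneg hr0.le).2 fun i => ?_)
      (lt_of_le_of_lt (min_le_left _ _) (half_lt_self hρ))
    fin_cases i
    · exact (abs_of_nonneg h1).trans_le h2
    · exact h3
    · exact h4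
  have hε2 : ε ^ 2 = 1 := by rw [← sq_abs, hε, one_pow]
  have hκne : κ ≠ 0 := fun h => by simp [h] at hκ0
  obtain ⟨C₁, hC₁, hpair⟩ := exists_norm_pairing_le hΩ hU.1 hU.2.1 hr0.le hr0.le hbox
  obtain ⟨C₂, hC₂, hker⟩ := exists_norm_heatKernel_le hκ0 (ε := ε) hδ0 hr0.le
  set C₃ : ℝ := ‖κ‖ + ‖1 + Complex.I * ε * a‖ + 1 with hC₃
  set I : ℝ := ∫ z : ℝ × ℝ, 1 * ‖profile ε s z.2‖ ∂((volume.restrict (Icc (-r) r)).prod volume)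
    with hI
  have hI0 : 0 ≤ I := integral_nonneg fun z => by positivity
  refine ⟨r, r, δ, ‖κ‖⁻¹ * (C₁ * (C₃ * C₂)) + I * C₂, hr0, hr0, hδ0, fun β hβ => ?_⟩
  set X : ℝ := (1 + β) ^ 2 * Real.exp (β ^ 2 / (4 * δ)) with hX
  have hX0 : 0 ≤ X := by positivity
  set b : ℂ := β - Complex.I * κ.im * r with hb
  set B : ℂ := ((β + κ.re * r : ℝ) : ℂ) with hB
  have hbB : b + κ * (r - (0 : ℝ)) = B := by
    rw [hb, hB]
    push_cast
    linear_combination (r : ℂ) * (Complex.re_add_im κ).symm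
  have hbound := hpair (testSolution a κ b ε δ r) (C₃ * C₂ * X)
    (isAdjointSolution_testSolution b r hδ0 hε2 hκ) (by positivity) ?_
  rotate_left
  · intro p hp hcase i
    obtain ⟨⟨h1, h2⟩, h3, h4⟩ := mem_box.1 hp
    have hcase' : p 0 = r ∨ 2 * δ ≤ δ + p 1 ^ 2 / 2 ∨ δ ≤ |ε * p 2| := by
      rcases hcase with h | h | h
      · exact Or.inl h
      · refine Or.inr (Or.inl ?_)
        rw [← sq_abs, h, hδ]; linarith
      · refine Or.inr (Or.inr ?_)
        rw [abs_mul, hε, one_mul, h]; exact hδr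
    obtain ⟨hD, hDD⟩ := hker β (p 0) (p 1) (p 2) hβ h1 h2 hcase'
    have hx : ‖((p 1 : ℝ) : ℂ)‖ ≤ 1 := by
      rw [Complex.norm_real]; exact h3.trans hr1
    have hCX : 0 ≤ C₂ * X := by positivity
    have hIε : ‖Complex.I * (ε : ℂ)‖ = 1 := by simp [hε]
    rw [mul_assoc]
    fin_cases i
    · change ‖-κ * heatKernelD _ _‖ ≤ _
      rw [norm_mul, norm_neg]
      refine mul_le_mul ?_ hD (norm_nonneg _) (by positivity)
      rw [hC₃]; linarith [norm_nonneg (1 + Complex.I * ε * a)]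
    · change ‖((p 1 : ℝ) : ℂ) * ((1 + Complex.I * ε * a) * heatKernelDD _ _)‖ ≤ _
      rw [norm_mul, norm_mul]
      refine (mul_le_of_le_one_left (by positivity) hx).trans ?_
      refine mul_le_mul ?_ hDD (norm_nonneg _) (by positivity)
      rw [hC₃]; linarith [norm_nonneg κ]
    · change ‖((p 1 : ℝ) : ℂ) * ((Complex.I * ε) * heatKernelDD _ _)‖ ≤ _
      rw [norm_mul, norm_mul, hIε]
      refine (mul_le_of_le_one_left (by positivity) hx).trans ?_
      refine mul_le_mul ?_ hDD (norm_nonneg _) (by positivity)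
      rw [hC₃]; linarith [norm_nonneg κ, norm_nonneg (1 + Complex.I * ε * a)]
  -- The bottom of the box carries the pairing over `|y| ≤ r`; the rest of the line `|y| > r`, where
  -- the packets are small, is added so that the `y`-integral becomes a Fourier transform.
  set g : ℝ × ℝ → ℂ := fun z => profile ε s z.2 * heatKernelD (phase ε δ z.1 z.2) B with hg
  have hgint : Integrable g ((volume.restrict (Icc (-r) r)).prod volume) :=
    integrable_profile_mul_heatKernelD hε hs hδ0 B r
  have hinner : (∫ q in Icc (fun _ : Fin 2 => -r) (fun _ => r), ∑ i, U ![0, q 0, q 1] i *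
      testSolution a κ b ε δ r i ![0, q 0, q 1]) =
      -κ * ∫ z in Icc (-r) r ×ˢ Icc (-r) r, g z := by
    have hmp := volume_preserving_finTwoArrow ℝ
    have hset : Icc (fun _ : Fin 2 => -r) (fun _ => r) =
        (MeasurableEquiv.finTwoArrow : (Fin 2 → ℝ) ≃ᵐ ℝ × ℝ) ⁻¹' (Icc (-r) r ×ˢ Icc (-r) r) := by
      ext q
      simp [Pi.le_def, Fin.forall_fin_two, MeasurableEquiv.finTwoArrow]
    rw [← integral_const_mul, ← hmp.setIntegral_preimage_emb
      (MeasurableEquiv.finTwoArrow : (Fin 2 → ℝ) ≃ᵐ ℝ × ℝ).measurableEmbedding, ← hset]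
    refine setIntegral_congr_fun measurableSet_Icc fun q hq => ?_
    have hq0 : |q 0| ≤ r := abs_le.2 ⟨hq.1 0, hq.2 0⟩
    have hq1 : |q 1| ≤ r := abs_le.2 ⟨hq.1 1, hq.2 1⟩
    have hqΩ : ![0, q 0, q 1] ∈ Ω := hbox (mem_box.2 (by simp [hr0.le, hq0, hq1]))
    have hUq : U ![0, q 0, q 1] = ![profile ε s (q 1), 0, 0] := by
      rw [hU.2.2 _ _ hqΩ, hU₀ _ _ (hq0.trans hr1) (hq1.trans hr1)]
    have hT0 : testSolution a κ b ε δ r 0 ![0, q 0, q 1] =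
        -κ * heatKernelD (phase ε δ (q 0) (q 1)) B := by
      rw [← hbB]; rfl
    simp only [Fin.sum_univ_three, hUq, hT0, hg]
    simp [MeasurableEquiv.finTwoArrow]
    ring
  rw [hinner, norm_mul, norm_neg] at hbound
  have hsplit : (∫ x in Icc (-r) r, ∫ y, g (x, y)) = (∫ z in Icc (-r) r ×ˢ Icc (-r) r, g z) +
      ∫ z in Icc (-r) r ×ˢ (Icc (-r) r)ᶜ, g z := by
    rw [integral_integral (f := fun x y => g (x, y)) hgint,
      ← integral_add_compl (s := univ ×ˢ Icc (-r) r) (MeasurableSet.univ.prod measurableSet_Icc)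
        hgint]
    have h1 : ∀ S : Set ℝ, ((volume.restrict (Icc (-r) r)).prod (volume : Measure ℝ)).restrict
        (univ ×ˢ S) = (volume : Measure (ℝ × ℝ)).restrict (Icc (-r) r ×ˢ S) := fun S => by
      rw [← Measure.prod_restrict, Measure.restrict_univ, Measure.prod_restrict]; rfl
    have h2 : (univ ×ˢ Icc (-r) r : Set (ℝ × ℝ))ᶜ = univ ×ˢ (Icc (-r) r)ᶜ := by
      ext z; simp
    rw [h2, h1, h1]
  have hout : ‖∫ z in Icc (-r) r ×ˢ (Icc (-r) r)ᶜ, g z‖ ≤ I * C₂ * X := by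
    have h1 : (volume : Measure (ℝ × ℝ)).restrict (Icc (-r) r ×ˢ (Icc (-r) r)ᶜ) =
        ((volume.restrict (Icc (-r) r)).prod (volume : Measure ℝ)).restrict
          (univ ×ˢ (Icc (-r) r)ᶜ) := by
      rw [← Measure.prod_restrict, Measure.restrict_univ, Measure.prod_restrict]; rfl
    rw [h1]
    have hdom : Integrable (fun z : ℝ × ℝ => 1 * ‖profile ε s z.2‖)
        ((volume.restrict (Icc (-r) r)).prod volume) :=
      (integrable_const (1 : ℝ)).mul_prod (integrable_profile hε hs).norm
    calc ‖∫ z in univ ×ˢ (Icc (-r) r)ᶜ, g z ∂((volume.restrict (Icc (-r) r)).prod volume)‖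
        ≤ ∫ z in univ ×ˢ (Icc (-r) r)ᶜ, (1 * ‖profile ε s z.2‖) * (C₂ * X)
            ∂((volume.restrict (Icc (-r) r)).prod volume) := by
          refine norm_integral_le_of_norm_le (hdom.mul_const _).integrableOn ?_
          refine (ae_restrict_iff' (MeasurableSet.univ.prod measurableSet_Icc.compl)).2
            (Eventually.of_forall fun z hz => ?_)
          have hy : r ≤ |z.2| := by
            by_contra! h
            exact hz.2 ⟨(abs_lt.1 h).1.le, (abs_lt.1 h).2.le⟩
          have hk := (hker β 0 z.1 z.2 hβ le_rfl hr0.le (Or.inr (Or.inr (by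
            rw [abs_mul, hε, one_mul]; exact hδr.trans hy)))).1
          rw [← hb, hbB] at hk
          rw [hg, norm_mul, one_mul]
          gcongr
      _ ≤ ∫ z, (1 * ‖profile ε s z.2‖) * (C₂ * X)
            ∂((volume.restrict (Icc (-r) r)).prod volume) :=
          setIntegral_le_integral (hdom.mul_const _) (Eventually.of_forall fun z => by positivity)
      _ = I * C₂ * X := by rw [integral_mul_const, hI]; ring
  change ‖∫ x in Icc (-r) r, ∫ y, g (x, y)‖ ≤ _
  rw [hsplit]
  refine (norm_add_le _ _).trans ?_
  have hin : ‖∫ z in Icc (-r) r ×ˢ Icc (-r) r, g z‖ ≤ ‖κ‖⁻¹ * (C₁ * (C₃ * C₂)) * X := by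
    have h1 : 0 < ‖κ‖ := norm_pos_iff.2 hκne
    rw [mul_assoc, ← div_eq_inv_mul, le_div_iff₀ h1]
    linarith
  linarith

/-! ### The lower bound for the pairing -/

theorem integrable_mul_cexp_quadratic {A : ℂ} (hA : 0 < A.re) (B : ℂ) :
    Integrable fun σ : ℝ => (σ : ℂ) * Complex.exp (-A * σ ^ 2 + B * σ) := by
  have h1 := (integrable_cexp_quadratic hA (B + 1) 0).norm
  have h2 := (integrable_cexp_quadratic hA (B - 1) 0).norm
  refine (h1.add h2).mono' (Continuous.aestronglyMeasurable (by fun_prop))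
    (Eventually.of_forall fun σ => ?_)
  have e1 : Complex.exp (-A * σ ^ 2 + (B + 1) * σ + 0) =
      Complex.exp (-A * σ ^ 2 + B * σ) * (Real.exp σ : ℂ) := by
    rw [Complex.ofReal_exp, ← Complex.exp_add]; congr 1; ring
  have e2 : Complex.exp (-A * σ ^ 2 + (B - 1) * σ + 0) =
      Complex.exp (-A * σ ^ 2 + B * σ) * (Real.exp (-σ) : ℂ) := by
    rw [Complex.ofReal_exp, ← Complex.exp_add]; congr 1; push_cast; ring
  simp only [Pi.add_apply]
  rw [e1, e2, norm_mul, norm_mul, norm_mul, Complex.norm_real, Complex.norm_real,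
    Complex.norm_real, Real.norm_eq_abs, Real.norm_of_nonneg (Real.exp_pos _).le,
    Real.norm_of_nonneg (Real.exp_pos _).le, ← mul_add, mul_comm]
  gcongr
  rcases abs_cases σ with ⟨h, _⟩ | ⟨h, _⟩ <;> rw [h]
  · linarith [Real.add_one_le_exp σ, Real.exp_pos (-σ)]
  · linarith [Real.add_one_le_exp (-σ), Real.exp_pos σ]

theorem cpow_pi_div_eq {A : ℂ} (hA : 0 < A.re) :
    ((Real.pi : ℂ) / A) ^ (1 / 2 : ℂ) = Real.sqrt Real.pi * Complex.exp (-(Complex.log A / 2)) := by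
  have hA0 : A ≠ 0 := fun h => by simp [h] at hA
  have hpi : ((Real.pi : ℝ) : ℂ) ≠ 0 := by exact_mod_cast Real.pi_ne_zero
  have harg : A.arg ≠ Real.pi := fun h => by
    have := Complex.arg_eq_pi_iff.1 h
    linarith [this.1]
  have hlog : Complex.log (Real.pi / A) = Real.log Real.pi - Complex.log A := by
    rw [div_eq_mul_inv, Complex.log_ofReal_mul Real.pi_pos (inv_ne_zero hA0),
      Complex.log_inv _ harg, sub_eq_add_neg]
  have hsqrt : (Real.sqrt Real.pi : ℂ) = Complex.exp (Real.log Real.pi / 2) := by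
    rw [← Complex.ofReal_ofNat, ← Complex.ofReal_div, ← Complex.ofReal_exp,
      Real.sqrt_eq_rpow, Real.rpow_def_of_pos Real.pi_pos]
    congr 2
    ring
  rw [Complex.cpow_def_of_ne_zero (div_ne_zero hpi hA0), hlog, hsqrt, ← Complex.exp_add]
  congr 1
  ring

/-- The derivative in `B` of `∫ e^{-Aσ² + Bσ} dσ`, obtained from the vanishing of the integral of
`d/dσ e^{-Aσ² + Bσ}`. -/
theorem integral_mul_cexp_quadratic {A : ℂ} (hA : 0 < A.re) (B : ℂ) :
    ∫ σ : ℝ, (σ : ℂ) * Complex.exp (-A * σ ^ 2 + B * σ) =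
      Real.sqrt Real.pi * heatKernelD A B := by
  have hA0 : A ≠ 0 := fun h => by simp [h] at hA
  have hi0 : Integrable fun σ : ℝ => Complex.exp (-A * σ ^ 2 + B * σ) := by
    simpa using integrable_cexp_quadratic hA B 0
  have hi1 := integrable_mul_cexp_quadratic hA B
  have hint : ∫ σ : ℝ, Complex.exp (-A * σ ^ 2 + B * σ) =
      Real.sqrt Real.pi * heatKernel A B := by
    have h := integral_cexp_quadratic (show (-A).re < 0 by simpa using hA) B 0
    simp only [add_zero] at h
    rw [h, neg_neg, cpow_pi_div_eq hA, heatKernel, mul_assoc, ← Complex.exp_add]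
    congr 2
    field_simp
    ring
  have hder : ∀ σ : ℝ, HasDerivAt (fun σ : ℝ => Complex.exp (-A * σ ^ 2 + B * σ))
      (-(2 * A) * ((σ : ℂ) * Complex.exp (-A * σ ^ 2 + B * σ)) +
        B * Complex.exp (-A * σ ^ 2 + B * σ)) σ := by
    intro σ
    have h1 : HasDerivAt (fun z : ℂ => Complex.exp (-A * z ^ 2 + B * z))
        (Complex.exp (-A * (σ : ℂ) ^ 2 + B * σ) * (-A * (2 * (σ : ℂ)) + B)) (σ : ℂ) := by
      have h2 := (((hasDerivAt_id (σ : ℂ)).pow 2).const_mul (-A)).add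
        ((hasDerivAt_id (σ : ℂ)).const_mul B)
      simpa using h2.cexp
    convert h1.comp_ofReal using 1
    ring
  have hzero := integral_eq_zero_of_hasDerivAt_of_integrable hder
    ((hi1.const_mul _).add (hi0.const_mul _)) hi0
  rw [integral_add (hi1.const_mul _) (hi0.const_mul _), integral_const_mul, integral_const_mul,
    hint] at hzero
  rw [heatKernelD]
  generalize (∫ σ : ℝ, (σ : ℂ) * Complex.exp (-A * σ ^ 2 + B * σ)) = J at *
  field_simp
  linear_combination -hzero

/-- The Fourier transform of `profile ε s` at the frequency `ε θ`, a positive combination of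
Gaussians. -/
def profileTransform (s θ : ℝ) : ℝ :=
  ∑' j : ℕ, Real.exp (-2 * j) * (Real.sqrt Real.pi * Real.exp (-((j : ℝ) ^ s - θ) ^ 2 / 4))

theorem summable_profileTransform (s θ : ℝ) : Summable fun j : ℕ =>
    Real.exp (-2 * j) * (Real.sqrt Real.pi * Real.exp (-((j : ℝ) ^ s - θ) ^ 2 / 4)) := by
  refine (summable_exp_neg_two_mul_nat.mul_right (Real.sqrt Real.pi)).of_nonneg_of_le
    (fun j => by positivity) fun j => ?_
  gcongr
  refine mul_le_of_le_one_right (by positivity) (Real.exp_le_one_iff.2 ?_)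
  have := sq_nonneg ((j : ℝ) ^ s - θ)
  linarith

theorem profileTransform_nonneg (s θ : ℝ) : 0 ≤ profileTransform s θ :=
  tsum_nonneg fun j => by positivity

theorem exp_mul_le_profileTransform (s θ : ℝ) (j : ℕ) :
    Real.exp (-2 * j) * (Real.sqrt Real.pi * Real.exp (-((j : ℝ) ^ s - θ) ^ 2 / 4)) ≤
      profileTransform s θ :=
  (summable_profileTransform s θ).le_tsum j fun i _ => by positivity

theorem integral_profile_mul_cexp {ε : ℝ} (hε : |ε| = 1) (s θ : ℝ) :
    ∫ y : ℝ, profile ε s y * Complex.exp (-(Complex.I * ε * θ) * y) = profileTransform s θ := by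
  have hε2 : (ε : ℂ) ^ 2 = 1 := by
    have : ε ^ 2 = 1 := by rw [← sq_abs, hε, one_pow]
    exact_mod_cast this
  set F : ℕ → ℝ → ℂ := fun j y => (Real.exp (-2 * j) : ℂ) *
    Complex.exp (-1 * (y : ℂ) ^ 2 + (Complex.I * ε * (((j : ℝ) ^ s : ℝ) - θ)) * y + 0) with hF
  have hF' : ∀ j y, F j y = Complex.exp (-(y : ℂ) ^ 2) * ((Real.exp (-2 * j) : ℂ) *
      Complex.exp (Complex.I * ((ε * (j : ℝ) ^ s : ℝ) : ℂ) * y)) *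
      Complex.exp (-(Complex.I * ε * θ) * y) := fun j y => by
    rw [hF, mul_left_comm, mul_assoc, mul_assoc, ← Complex.exp_add, ← Complex.exp_add]
    push_cast
    ring_nf
  have hexp1 : ∀ y : ℝ, ‖Complex.exp (-(Complex.I * ε * θ) * y)‖ = 1 := fun y => by
    have : -(Complex.I * ε * θ) * (y : ℂ) = ((-(ε * θ * y) : ℝ) : ℂ) * Complex.I := by
      push_cast; ring
    rw [this, Complex.norm_exp_ofReal_mul_I]
  have hFn : ∀ j y, ‖F j y‖ = Real.exp (-2 * j) * Real.exp (-1 * y ^ 2) := fun j y => by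
    rw [hF', norm_mul, norm_mul, norm_gevreySeries_term, norm_cexp_neg_sq, hexp1, mul_one,
      mul_comm]
  have hFi : ∀ j, Integrable (F j) := fun j =>
    (integrable_cexp_quadratic (b := 1) (by simp) _ 0).const_mul _
  have hsum : Summable fun j => ∫ y, ‖F j y‖ := by
    simp_rw [hFn, integral_const_mul]
    exact summable_exp_neg_two_mul_nat.mul_right _
  have hFint : ∀ j, ∫ y, F j y = ((Real.exp (-2 * j) *
      (Real.sqrt Real.pi * Real.exp (-((j : ℝ) ^ s - θ) ^ 2 / 4)) : ℝ) : ℂ) := fun j => by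
    have h1 := integral_cexp_quadratic (b := -1) (by simp)
      (Complex.I * ε * (((j : ℝ) ^ s : ℝ) - θ)) 0
    have h2 := cpow_pi_div_eq (A := 1) (by simp)
    rw [hF, integral_const_mul, h1, neg_neg, h2]
    push_cast
    congr 2
    · simp
    · congr 1
      linear_combination (-((((j : ℝ) ^ s : ℝ) : ℂ) - θ) ^ 2 / 4 * hε2) +
        ((((j : ℝ) ^ s : ℝ) : ℂ) - θ) ^ 2 / 4 * ε ^ 2 * Complex.I_sq
  have hS := hasSum_integral_of_summable_integral_norm hFi hsum
  have htsum : ∀ y : ℝ, ∑' j, F j y = profile ε s y * Complex.exp (-(Complex.I * ε * θ) * y) :=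
    fun y => by
      simp_rw [hF', profile, gevreySeries]
      rw [tsum_mul_right, tsum_mul_left]
  simp_rw [htsum, hFint] at hS
  exact hS.unique (Complex.hasSum_ofReal.2 (summable_profileTransform s θ).hasSum)

/-- The density, in the square root `σ` of the frequency, of the pairing of `profile` with a wave
packet. -/
def pairingDensity (s p B σ : ℝ) : ℝ :=
  profileTransform s (σ ^ 2) * (σ * Real.exp (-p * σ ^ 2 + B * σ))

/-- For fixed `x` the pairing in `y` is computed by Fubini from the superposition formula for the
packets and the Fourier transform of the profile. -/
theorem integrable_pairingDensity_and_integral_eq {ε s δ : ℝ} (hε : |ε| = 1) (hs : 1 ≤ s)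
    (hδ : 0 < δ) (x B : ℝ) :
    Integrable (pairingDensity s (δ + x ^ 2 / 2) B) ∧
      Real.sqrt Real.pi * ∫ y, profile ε s y * heatKernelD (phase ε δ x y) B =
        ((∫ σ, pairingDensity s (δ + x ^ 2 / 2) B σ : ℝ) : ℂ) := by
  set p : ℝ := δ + x ^ 2 / 2 with hp
  have hp0 : 0 < p := by positivity
  set G : ℝ → ℝ → ℂ := fun y σ =>
    (profile ε s y * Complex.exp (-(Complex.I * ε * (σ ^ 2 : ℝ)) * y)) *
    ((σ : ℂ) * Complex.exp (-(p : ℂ) * σ ^ 2 + B * σ)) with hG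
  have hGint : Integrable (Function.uncurry G) (volume.prod volume) := by
    have hdom : Integrable (fun z : ℝ × ℝ => ‖profile ε s z.1‖ *
        ‖(z.2 : ℂ) * Complex.exp (-(p : ℂ) * (z.2 : ℂ) ^ 2 + B * z.2)‖) (volume.prod volume) :=
      (integrable_profile hε hs).norm.mul_prod
        (integrable_mul_cexp_quadratic (A := (p : ℂ)) (by simpa using hp0) B).norm
    refine hdom.mono' ?_ (Eventually.of_forall fun z => ?_)
    · have hc : Continuous (profile ε s) := continuous_profile hε hs
      refine Continuous.aestronglyMeasurable ?_
      simp only [hG, Function.uncurry_def]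
      fun_prop
    · have h1 : ‖Complex.exp (-(Complex.I * ε * (z.2 ^ 2 : ℝ)) * z.1)‖ = 1 := by
        have : -(Complex.I * ε * (z.2 ^ 2 : ℝ)) * (z.1 : ℂ) =
            ((-(ε * z.2 ^ 2 * z.1) : ℝ) : ℂ) * Complex.I := by push_cast; ring
        rw [this, Complex.norm_exp_ofReal_mul_I]
      simp only [hG, Function.uncurry_def]
      rw [norm_mul, norm_mul (profile ε s z.1), h1, mul_one]
  have hGy : ∀ σ, ∫ y, G y σ = ((pairingDensity s p B σ : ℝ) : ℂ) := fun σ => by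
    simp only [hG]
    rw [integral_mul_const, integral_profile_mul_cexp hε, pairingDensity]
    push_cast
    rfl
  have hGσ : ∀ y, ∫ σ, G y σ =
      Real.sqrt Real.pi * (profile ε s y * heatKernelD (phase ε δ x y) B) := fun y => by
    rw [mul_left_comm, ← integral_mul_cexp_quadratic (phase_re_pos hδ x y), ← integral_const_mul]
    refine integral_congr_ae (Eventually.of_forall fun σ => ?_)
    simp only [hG, phase, hp]
    rw [mul_assoc, mul_left_comm (Complex.exp _), ← Complex.exp_add]
    congr 3
    push_cast
    ring
  constructor
  · have h := hGint.integral_prod_right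
    simp only [Function.uncurry_def] at h
    simp_rw [hGy] at h
    exact h.re.congr (Eventually.of_forall fun σ => by simp)
  · rw [← integral_const_mul]
    simp_rw [← hGσ]
    rw [integral_integral_swap hGint]
    simp_rw [hGy]
    exact integral_ofReal

/-- Averaging over `σ ↦ -σ` makes the density nonnegative. -/
theorem integral_pairingDensity_eq (s p B : ℝ) (h : Integrable (pairingDensity s p B)) :
    Integrable (fun σ => profileTransform s (σ ^ 2) * Real.exp (-p * σ ^ 2) *
      (σ * (Real.exp (B * σ) - Real.exp (-(B * σ))))) ∧
    2 * ∫ σ, pairingDensity s p B σ = ∫ σ, profileTransform s (σ ^ 2) * Real.exp (-p * σ ^ 2) *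
      (σ * (Real.exp (B * σ) - Real.exp (-(B * σ)))) := by
  have hfun : (fun σ => profileTransform s (σ ^ 2) * Real.exp (-p * σ ^ 2) *
      (σ * (Real.exp (B * σ) - Real.exp (-(B * σ))))) =
      fun σ => pairingDensity s p B σ + pairingDensity s p B (-σ) := by
    funext σ
    rw [pairingDensity, pairingDensity, neg_sq, Real.exp_add, Real.exp_add, mul_neg]
    ring
  rw [hfun]
  refine ⟨h.add h.comp_neg, ?_⟩
  rw [integral_add h h.comp_neg, integral_neg_eq_self]
  ring

theorem symmetrized_nonneg (s p : ℝ) {B : ℝ} (hB : 0 ≤ B) (σ : ℝ) :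
    0 ≤ profileTransform s (σ ^ 2) * Real.exp (-p * σ ^ 2) *
      (σ * (Real.exp (B * σ) - Real.exp (-(B * σ)))) := by
  have hW := profileTransform_nonneg s (σ ^ 2)
  refine mul_nonneg (by positivity) ?_
  rcases le_total 0 σ with h | h
  · have h1 : 0 ≤ B * σ := by positivity
    exact mul_nonneg h (sub_nonneg.2 (Real.exp_le_exp.2 (by linarith)))
  · have h1 : B * σ ≤ 0 := mul_nonpos_of_nonneg_of_nonpos hB h
    exact mul_nonneg_of_nonpos_of_nonpos h (sub_nonpos.2 (Real.exp_le_exp.2 (by linarith)))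

theorem integral_pairingDensity_nonneg {s p B : ℝ} (hB : 0 ≤ B)
    (h : Integrable (pairingDensity s p B)) : 0 ≤ ∫ σ, pairingDensity s p B σ := by
  have h1 : 0 ≤ 2 * ∫ σ, pairingDensity s p B σ := by
    rw [(integral_pairingDensity_eq s p B h).2]
    exact integral_nonneg fun σ => symmetrized_nonneg s p hB σ
  linarith

/-- If `R²` is the `j`-th frequency of the profile and the packet is centred at `σ = R`, then on the
window `[R, R + 1/R]` neither `e^{-δ(σ - R)²}` nor the Gaussian of the profile at that frequency is
small. -/
theorem le_symmetrized {s δ x k R : ℝ} {j : ℕ} (hδ : 0 < δ) (hk : 0 ≤ k) (hR : 1 ≤ R)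
    (hRj : R ^ 2 = (j : ℝ) ^ s) (hR2 : 1 ≤ 2 * δ * R ^ 2) (hx : |x| * (R + 1) ≤ 1) {σ : ℝ}
    (hσ : σ ∈ Icc R (R + 1 / R)) :
    Real.exp (δ * R ^ 2) * Real.exp (k * R - 2 * j - (δ + 3)) / 2 ≤
      profileTransform s (σ ^ 2) * Real.exp (-(δ + x ^ 2 / 2) * σ ^ 2) *
      (σ * (Real.exp ((2 * δ * R + k) * σ) - Real.exp (-((2 * δ * R + k) * σ)))) := by
  have hR0 : 0 < R := by linarith
  obtain ⟨h1, h2⟩ := hσ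
  have hinv : 1 / R ≤ 1 := by rw [div_le_one hR0]; exact hR
  have hd0 : 0 ≤ σ - R := by linarith
  have hd1 : σ - R ≤ 1 / R := by linarith
  have hRd : R * (σ - R) ≤ 1 := by
    calc R * (σ - R) ≤ R * (1 / R) := by gcongr
      _ = 1 := by field_simp
  have hsq : σ ^ 2 - R ^ 2 ≤ 3 := by nlinarith
  have hsq0 : 0 ≤ σ ^ 2 - R ^ 2 := by nlinarith
  have hW : Real.exp (-2 * j - 9 / 4) ≤ profileTransform s (σ ^ 2) := by
    refine le_trans ?_ (exp_mul_le_profileTransform s (σ ^ 2) j)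
    rw [sub_eq_add_neg, Real.exp_add]
    gcongr
    have h3 : Real.exp (-(9 / 4)) ≤ Real.exp (-((j : ℝ) ^ s - σ ^ 2) ^ 2 / 4) := by
      refine Real.exp_le_exp.2 ?_
      rw [← hRj]
      nlinarith
    have h4 : 1 ≤ Real.sqrt Real.pi := Real.one_le_sqrt.2 (by linarith [Real.pi_gt_three])
    calc Real.exp (-(9 / 4)) ≤ 1 * Real.exp (-((j : ℝ) ^ s - σ ^ 2) ^ 2 / 4) := by linarith
      _ ≤ _ := by gcongr
  have hBσ : 1 ≤ (2 * δ * R + k) * σ := by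
    have : 2 * δ * R ^ 2 ≤ (2 * δ * R + k) * σ := by
      calc 2 * δ * R ^ 2 = (2 * δ * R + 0) * R := by ring
        _ ≤ (2 * δ * R + k) * σ := by gcongr
    linarith
  have hsinh : Real.exp ((2 * δ * R + k) * σ) / 2 ≤
      σ * (Real.exp ((2 * δ * R + k) * σ) - Real.exp (-((2 * δ * R + k) * σ))) := by
    set u := (2 * δ * R + k) * σ
    have e1 : 2 ≤ Real.exp u := by linarith [Real.add_one_le_exp u]
    have e2 : Real.exp (-u) ≤ 1 := Real.exp_le_one_iff.2 (by linarith)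
    nlinarith
  have hxσ : x ^ 2 * σ ^ 2 ≤ 1 := by
    have e1 : |x| * σ ≤ 1 := le_trans (by gcongr; linarith) hx
    have e2 : 0 ≤ |x| * σ := mul_nonneg (abs_nonneg _) (by linarith)
    calc x ^ 2 * σ ^ 2 = (|x| * σ) ^ 2 := by rw [mul_pow, sq_abs]
      _ ≤ 1 := pow_le_one₀ e2 e1
  have hσ0 : 0 ≤ profileTransform s (σ ^ 2) := profileTransform_nonneg _ _
  calc Real.exp (δ * R ^ 2) * Real.exp (k * R - 2 * j - (δ + 3)) / 2
      ≤ Real.exp (-2 * j - 9 / 4) * Real.exp (-(δ + x ^ 2 / 2) * σ ^ 2) *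
        (Real.exp ((2 * δ * R + k) * σ) / 2) := by
        rw [← Real.exp_add, ← mul_div_assoc, ← Real.exp_add, ← Real.exp_add]
        refine div_le_div_of_nonneg_right (Real.exp_le_exp.2 ?_) (by norm_num)
        have e1 : δ * (σ - R) ^ 2 ≤ δ := by
          refine mul_le_of_le_one_right hδ.le (pow_le_one₀ hd0 (hd1.trans hinv))
        have e2 : k * R ≤ k * σ := by gcongr
        nlinarith
    _ ≤ _ := by gcongr

theorem le_integral_pairingDensity {s δ x k R : ℝ} {j : ℕ} (hδ : 0 < δ) (hk : 0 ≤ k) (hR : 1 ≤ R)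
    (hRj : R ^ 2 = (j : ℝ) ^ s) (hR2 : 1 ≤ 2 * δ * R ^ 2) (hx : |x| * (R + 1) ≤ 1)
    (h : Integrable (pairingDensity s (δ + x ^ 2 / 2) (2 * δ * R + k))) :
    Real.exp (δ * R ^ 2) * Real.exp (k * R - 2 * j - (δ + 3)) / (4 * R) ≤
      ∫ σ, pairingDensity s (δ + x ^ 2 / 2) (2 * δ * R + k) σ := by
  have hR0 : 0 < R := by linarith
  obtain ⟨hi, he⟩ := integral_pairingDensity_eq _ _ _ h
  set c := Real.exp (δ * R ^ 2) * Real.exp (k * R - 2 * j - (δ + 3)) with hc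
  have h1 : c / 2 * (1 / R) ≤ 2 * ∫ σ, pairingDensity s (δ + x ^ 2 / 2) (2 * δ * R + k) σ := by
    rw [he]
    calc c / 2 * (1 / R) = ∫ σ in Icc R (R + 1 / R), c / 2 := by
          have : 0 ≤ 1 / R := by positivity
          rw [setIntegral_const, measureReal_def, Real.volume_Icc, add_sub_cancel_left,
            ENNReal.toReal_ofReal this, smul_eq_mul, mul_comm]
      _ ≤ ∫ σ in Icc R (R + 1 / R), _ :=
          setIntegral_mono_on (integrableOn_const (by simp)) hi.integrableOn measurableSet_Icc
            fun σ hσ => le_symmetrized hδ hk hR hRj hR2 hx hσ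
      _ ≤ _ := setIntegral_le_integral hi
          (Eventually.of_forall (symmetrized_nonneg _ _ (by positivity)))
  have h2 : c / (4 * R) = (c / 2 * (1 / R)) / 2 := by field_simp; norm_num
  rw [h2]
  linarith

theorem le_norm_integral_profile {ε s δ k r R : ℝ} {j : ℕ} (hε : |ε| = 1) (hs : 1 ≤ s)
    (hδ : 0 < δ) (hk : 0 ≤ k) (hR : 1 ≤ R) (hRj : R ^ 2 = (j : ℝ) ^ s)
    (hR2 : 1 ≤ 2 * δ * R ^ 2) (hr : 1 ≤ r * (R + 1)) :
    Real.exp (δ * R ^ 2) * Real.exp (k * R - 2 * j - (δ + 3)) / (4 * R * (R + 1)) ≤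
      Real.sqrt Real.pi * ‖∫ x in Icc (-r) r, ∫ y, profile ε s y *
        heatKernelD (phase ε δ x y) ((2 * δ * R + k : ℝ) : ℂ)‖ := by
  have hR0 : 0 < R := by linarith
  set B : ℝ := 2 * δ * R + k with hB
  have hB0 : 0 ≤ B := by positivity
  set J : ℝ → ℝ := fun x => ∫ σ, pairingDensity s (δ + x ^ 2 / 2) B σ with hJ
  have hJeq : ∀ x, Real.sqrt Real.pi * ∫ y, profile ε s y * heatKernelD (phase ε δ x y) B =
      ((J x : ℝ) : ℂ) := fun x => (integrable_pairingDensity_and_integral_eq hε hs hδ x B).2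
  have hJi : IntegrableOn J (Icc (-r) r) := by
    have h := ((integrable_profile_mul_heatKernelD hε hs hδ (B : ℂ) r).integral_prod_left).const_mul
      (Real.sqrt Real.pi : ℂ)
    simp_rw [hJeq] at h
    exact h.re.congr (Eventually.of_forall fun x => by simp)
  have hJ0 : ∀ x, 0 ≤ J x := fun x =>
    integral_pairingDensity_nonneg hB0 (integrable_pairingDensity_and_integral_eq hε hs hδ x B).1
  have hnorm : Real.sqrt Real.pi * ‖∫ x in Icc (-r) r, ∫ y, profile ε s y *
      heatKernelD (phase ε δ x y) (B : ℂ)‖ = ∫ x in Icc (-r) r, J x := by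
    have h1 : (Real.sqrt Real.pi : ℂ) * (∫ x in Icc (-r) r, ∫ y, profile ε s y *
        heatKernelD (phase ε δ x y) (B : ℂ)) = ((∫ x in Icc (-r) r, J x : ℝ) : ℂ) := by
      rw [← integral_const_mul]
      simp_rw [hJeq]
      exact integral_ofReal
    have h2 := congrArg norm h1
    rwa [norm_mul, Complex.norm_real, Complex.norm_real,
      Real.norm_of_nonneg (Real.sqrt_nonneg _),
      Real.norm_of_nonneg (integral_nonneg fun x => hJ0 x)] at h2
  rw [hnorm]
  set c := Real.exp (δ * R ^ 2) * Real.exp (k * R - 2 * j - (δ + 3)) with hc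
  set w : ℝ := 1 / (R + 1) with hw
  have hw0 : 0 ≤ w := by positivity
  have hwr : w ≤ r := by rw [hw, div_le_iff₀ (by positivity)]; exact hr
  have hsub : Icc 0 w ⊆ Icc (-r) r := Icc_subset_Icc (by linarith) hwr
  calc c / (4 * R * (R + 1)) = ∫ x in Icc 0 w, c / (4 * R) := by
        rw [setIntegral_const, measureReal_def, Real.volume_Icc, sub_zero,
          ENNReal.toReal_ofReal hw0, smul_eq_mul, hw]
        field_simp
    _ ≤ ∫ x in Icc 0 w, J x := by
        refine setIntegral_mono_on (integrableOn_const (by simp)) (hJi.mono_set hsub)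
          measurableSet_Icc fun x hx => ?_
        refine le_integral_pairingDensity hδ hk hR hRj hR2 ?_
          (integrable_pairingDensity_and_integral_eq hε hs hδ x B).1
        rw [abs_of_nonneg hx.1, ← le_div_iff₀ (by positivity)]
        exact hx.2
    _ ≤ ∫ x in Icc (-r) r, J x :=
        setIntegral_mono_set hJi (Eventually.of_forall fun x => hJ0 x) hsub.eventuallyLE

/-! ### Nonsolvability -/

/-- The growth rate `κ`: the sign `ε` of the frequency is chosen so that `-(1 + iεa)` is not a
nonpositive real number. -/
theorem exists_growth_rate {a : ℂ}
    (ha : Complex.I * a ∉ (fun r : ℝ => (r : ℂ)) '' Set.Icc (-1 : ℝ) 1) :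
    ∃ (ε : ℝ) (κ : ℂ), |ε| = 1 ∧ 0 < κ.re ∧ κ ^ 2 = -(1 + Complex.I * ε * a) := by
  have hsqrt : ∀ z ∈ Complex.slitPlane, ∃ κ : ℂ, 0 < κ.re ∧ κ ^ 2 = z := by
    intro z hz
    refine ⟨Complex.exp (Complex.log z / 2), ?_, ?_⟩
    · have him : (Complex.log z / 2).im = z.arg / 2 := by
        rw [← Complex.ofReal_ofNat, Complex.div_ofReal_im, Complex.log_im]
      rw [Complex.exp_re, him]
      have h1 := Complex.neg_pi_lt_arg z
      have h2 := lt_of_le_of_ne (Complex.arg_le_pi z) (Complex.mem_slitPlane_iff_arg.1 hz).1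
      exact mul_pos (Real.exp_pos _) (Real.cos_pos_of_mem_Ioo ⟨by linarith, by linarith⟩)
    · rw [← Complex.exp_nat_mul]
      have : ((2 : ℕ) : ℂ) * (Complex.log z / 2) = Complex.log z := by push_cast; ring
      rw [this, Complex.exp_log (Complex.slitPlane_ne_zero hz)]
  suffices h : ∃ ε : ℝ, |ε| = 1 ∧ -(1 + Complex.I * ε * a) ∈ Complex.slitPlane by
    obtain ⟨ε, hε, hz⟩ := h
    obtain ⟨κ, hκ⟩ := hsqrt _ hz
    exact ⟨ε, κ, hε, hκ⟩
  set c : ℂ := Complex.I * a with hc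
  have hval : ∀ ε : ℝ, -(1 + Complex.I * ε * a) = -(1 + ε * c) := fun ε => by rw [hc]; ring
  simp_rw [hval, Complex.mem_slitPlane_iff]
  by_cases him : c.im = 0
  · have hre : c.re < -1 ∨ 1 < c.re := by
      by_contra! h
      exact ha ⟨c.re, ⟨h.1, h.2⟩, Complex.ext rfl (by simp [him])⟩
    rcases hre with h | h
    · exact ⟨1, by simp, Or.inl (by simp; linarith)⟩
    · exact ⟨-1, by simp, Or.inl (by simp; linarith)⟩
  · exact ⟨1, by simp, Or.inr (by simpa using him)⟩

/-- For `s > 2` the growth `e^{kR}` beats both the amplitude `e^{-2j}` of the frequency `R² = j^s`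
and any power of `R`. -/
theorem exists_large_frequency {s k M R₀ : ℝ} (hs : 2 < s) (hk : 0 < k) :
    ∃ (j : ℕ) (R : ℝ), R₀ ≤ R ∧ 1 ≤ R ∧ R ^ 2 = (j : ℝ) ^ s ∧
      M * (1 + R) ^ 4 < Real.exp (k * R - 2 * j) := by
  have hR : Tendsto (fun j : ℕ => (j : ℝ) ^ (s / 2)) atTop atTop :=
    (tendsto_rpow_atTop (by linarith)).comp tendsto_natCast_atTop_atTop
  have hq : Tendsto (fun j : ℕ => (j : ℝ) ^ (s / 2 - 1)) atTop atTop :=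
    (tendsto_rpow_atTop (by linarith)).comp tendsto_natCast_atTop_atTop
  have hdecay : Tendsto (fun j : ℕ => |M| * (16 * (2 / k) ^ 4) *
      ((k / 2 * (j : ℝ) ^ (s / 2)) ^ 4 * Real.exp (-(k / 2 * (j : ℝ) ^ (s / 2))))) atTop
      (𝓝 (|M| * (16 * (2 / k) ^ 4) * 0)) :=
    ((Real.tendsto_pow_mul_exp_neg_atTop_nhds_zero 4).comp
      (hR.const_mul_atTop (by positivity : 0 < k / 2))).const_mul _
  rw [mul_zero] at hdecay
  obtain ⟨j, hj0, hj1, hj2, hj3, hj4⟩ := ((eventually_gt_atTop 0).and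
    ((hR.eventually_ge_atTop R₀).and ((hR.eventually_ge_atTop 1).and
      ((hq.eventually_ge_atTop (4 / k)).and (hdecay.eventually_lt_const one_pos))))).exists
  have hj0' : (0 : ℝ) < j := by exact_mod_cast hj0
  set R : ℝ := (j : ℝ) ^ (s / 2) with hRdef
  refine ⟨j, R, hj1, hj2, ?_, ?_⟩
  · rw [hRdef, ← Real.rpow_natCast, ← Real.rpow_mul hj0'.le]
    congr 1
    push_cast
    ring
  · have h1 : R = j * (j : ℝ) ^ (s / 2 - 1) := by
      rw [hRdef, Real.rpow_sub hj0', Real.rpow_one]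
      field_simp
    have h2 : 2 * (j : ℝ) ≤ k / 2 * R := by
      rw [div_le_iff₀ hk] at hj3
      rw [h1]
      nlinarith
    have h3 : M * (1 + R) ^ 4 ≤ |M| * (16 * (2 / k) ^ 4) * (k / 2 * R) ^ 4 := by
      have e1 : (2 / k) ^ 4 * (k / 2 * R) ^ 4 = R ^ 4 := by
        rw [← mul_pow]; congr 1; field_simp
      calc M * (1 + R) ^ 4 ≤ |M| * (2 * R) ^ 4 := by
            gcongr
            · exact le_abs_self M
            · linarith
        _ = |M| * 16 * R ^ 4 := by ring
        _ = _ := by rw [← e1]; ring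
    rw [← mul_assoc, Real.exp_neg, ← div_eq_mul_inv, div_lt_one (Real.exp_pos _)] at hj4
    calc M * (1 + R) ^ 4 ≤ _ := h3
      _ < Real.exp (k / 2 * R) := hj4
      _ ≤ _ := Real.exp_le_exp.2 (by linarith)

theorem not_locallySolvable {a : ℂ}
    (ha : Complex.I * a ∉ (fun r : ℝ => (r : ℂ)) '' Set.Icc (-1 : ℝ) 1)
    {s : ℝ} (hs : 2 < s) : ¬ LocallySolvable a s := by
  intro hsolv
  obtain ⟨ε, κ, hε, hκ0, hκ⟩ := exists_growth_rate ha
  obtain ⟨U₀, hU₀G, hU₀⟩ := exists_isGevreyCompact_data hε hs.le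
  obtain ⟨Ω, hΩ, h0, U, hU⟩ := hsolv U₀ hU₀G
  obtain ⟨T, r, δ, C, hT, hr, hδ, hupper⟩ :=
    exists_norm_integral_profile_le hε (by linarith) hκ0 hκ hU₀ hΩ h0 hU
  have hk : 0 < κ.re * T := mul_pos hκ0 hT
  obtain ⟨j, R, hR₀, hR1, hRj, hlarge⟩ := exists_large_frequency (s := s) (k := κ.re * T)
    (M := Real.sqrt Real.pi * |C| * (1 + 2 * δ) ^ 2 * 4 * Real.exp (δ + 3))
    (R₀ := 1 / r + 1 / (2 * δ)) hs hk
  have hR0 : 0 < R := by linarith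
  have hi1 : 0 < 1 / r := by positivity
  have hi2 : 0 < 1 / (2 * δ) := by positivity
  have hR2 : 1 ≤ 2 * δ * R ^ 2 := by
    have h1 : 1 / (2 * δ) ≤ R := by linarith
    rw [div_le_iff₀ (by positivity)] at h1
    nlinarith
  have hrR : 1 ≤ r * (R + 1) := by
    have h1 : 1 / r ≤ R := by linarith
    rw [div_le_iff₀ hr] at h1
    nlinarith
  have hlower := le_norm_integral_profile (ε := ε) (k := κ.re * T) hε (by linarith) hδ hk.le hR1
    hRj hR2 hrR
  have hup := hupper (2 * δ * R) (by positivity)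
  have hexp : (2 * δ * R) ^ 2 / (4 * δ) = δ * R ^ 2 := by field_simp; norm_num
  rw [hexp] at hup
  set E := Real.exp (δ * R ^ 2) with hE
  have hE0 : 0 < E := Real.exp_pos _
  have h1 : E * Real.exp (κ.re * T * R - 2 * j - (δ + 3)) / (4 * R * (R + 1)) ≤
      Real.sqrt Real.pi * (|C| * ((1 + 2 * δ * R) ^ 2 * E)) := by
    refine hlower.trans ?_
    gcongr
    refine hup.trans ?_
    gcongr
    exact le_abs_self C
  rw [div_le_iff₀ (by positivity), Real.exp_sub] at h1
  have h2 : Real.exp (κ.re * T * R - 2 * j) ≤ (Real.sqrt Real.pi * |C| * (1 + 2 * δ * R) ^ 2 *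
      (4 * R * (R + 1))) * Real.exp (δ + 3) := by
    rw [← div_le_iff₀ (Real.exp_pos _)]
    refine le_of_mul_le_mul_left ?_ hE0
    linarith
  refine absurd hlarge (not_lt.2 (h2.trans ?_))
  have h3 : 1 + 2 * δ * R ≤ (1 + 2 * δ) * (1 + R) := by nlinarith
  have h4 : 4 * R * (R + 1) ≤ 4 * (1 + R) ^ 2 := by nlinarith
  calc _ ≤ (Real.sqrt Real.pi * |C| * ((1 + 2 * δ) * (1 + R)) ^ 2 * (4 * (1 + R) ^ 2)) *
        Real.exp (δ + 3) := by gcongr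
    _ = _ := by ring

end GevreyCauchy

end

theorem mainTheorem2 (a : ℂ)
    (ha : Complex.I * a ∉ (fun r : ℝ => (r : ℂ)) '' Set.Icc (-1 : ℝ) 1)
    (s : ℝ) (hs : 2 < s) :
    ¬ GevreyCauchy.LocallySolvable a s :=
  GevreyCauchy.not_locallySolvable ha hs
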